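/- **Definitions.** For $\varphi:\mathbb R\to\mathbb R$ put $I_+\varphi(u)=\int_{-\infty}^u\varphi(v)\,dv$, $I_-\varphi(u)=\int_u^\infty\varphi(v)\,dv$, and let $I_\pm^k$ denote the $k$-fold iterates; correspondingly $I_\pm^0\delta=\delta$, $I_\pm\delta(u)=H(\pm u)$ with $H=\mathbb 1_{(0,\infty)}$, and $I_\pm^{j}\delta=I_\pm^{j-1}(I_\pm\delta)$ for $j\ge1$. Let $n\ge 1$ and $r\ge 0$ be integers. A real function $g$ has $r$ vanishing moments of order $n$ if $\int_{\mathbb R}g(t^k)t^m\,dt=\int_{\mathbb R}g(-t^k)t^m\,dt=0$ for all $k\in\{1,\dots,n\}$ and $m\in\{0,\dots,kr-1\}$. An analyzing Taylorlet of order $n$ with $r$ vanishing moments is a function $\tau(x_1,x_2)=g(x_1)h(x_2)$ with real-valued $g,h\in\mathcal S(\mathbb R)$ such that $g$ has $r$ vanishing moments of order $n$; it is restrictive if moreover $I_+^ig(0)\neq0$ for all $i\in\{0,\dots,r\}$ and $\int_{\mathbb R}h\neq0$. For $\alpha>0$, $a>0$, $s=(s_0,\dots,s_n)\in\mathbb R^{n+1}$,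 $t\in\mathbb R$ put $$\tau_{a,s,t}(x)=a^{-(1+\alpha)/2}\,\tau\Big(a^{-1}\Big[x_1-\sum_{\ell=0}^n\frac{s_\ell}{\ell!}(x_2-t)^\ell\Big],\;a^{-\alpha}(x_2-t)\Big),\qquad \mathcal T^{(n,\alpha)}f(a,s,t)=\langle f,\tau_{a,s,t}\rangle .$$ For an integer $j\ge0$ and $q\in C^\infty(\mathbb R)$ (real-valued), the $j$-feasible function $f(x)=I_\pm^j\delta(x_1-q(x_2))$ with singularity function $q$ acts by $\langle f,\varphi\rangle=\int_{\mathbb R}\varphi(q(x_2),x_2)\,dx_2$ if $j=0$, and by $\langle f,\varphi\rangle=\int_{\mathbb R}\int_{\mathbb R}(I_\pm^j\delta)(x_1-q(x_2))\,\varphi(x_1,x_2)\,dx_1\,dx_2$ if $j\ge1$. For $k\in\{0,\dots,n\}$, $k$ is the highest approximation order of $s$ for $f$ in $t$ if $s_\ell=q^{(\ell)}(t)$ for all $\ell\le k$ and, in case $k<n$, $s_{k+1}\ne q^{(k+1)}(t)$. **Theorem.** Let $n\ge1$ and $0\le j<r$ be integers, let $\tau$ be an analyzing Taylorlet of order $n$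 with $r$ vanishing moments, and let $f=I_\pm^j\delta(x_1-q(x_2))$ be $j$-feasible with singularity function $q\in C^\infty(\mathbb R)$, for either choice of the sign. Let $\alpha>0$, $s\in\mathbb R^{n+1}$ and $t\in\mathbb R$. Then $\mathcal T^{(n,\alpha)}f(a,s,t)$ is well defined for every $a>0$ (the integrals above converge for $\varphi=\tau_{a,s,t}$), and: 1. If $s_0\ne q(t)$, then $\mathcal T^{(n,\alpha)}f(a,s,t)=O(a^N)$ as $a\to0^+$ for every $N>0$. 2. If $\alpha<\frac1n$ and $k\in\{0,\dots,n-1\}$ is the highest approximation order of $s$ for $f$ in $t$, then $\mathcal T^{(n,\alpha)}f(a,s,t)=O\big(a^{\,j+(\alpha-1)/2+(r-j)[1-(k+1)\alpha]}\big)$ as $a\to0^+$. 3. If $\alpha>\frac1{n+1}$, $\tau$ is restrictive, and $n$ is the highest approximation order of $s$ for $f$ in $t$, then there is a constant $c\ne0$ such that $\mathcal T^{(n,\alpha)}f(a,s,t)\big/\big(c\,a^{\,j+(\alpha-1)/2}\big)\to1$ as $a\to0^+$. -/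

import Mathlib

open Filter Topology MeasureTheory Asymptotics
open scoped SchwartzMap ContDiff

noncomputable section

namespace Taylorlet

/-- The two choices of sign in the iterated integrals `I_±`. -/
inductive Side
  | plus
  | minus

/-- `I_+ φ (u) = ∫_{-∞}^u φ(v) dv` and `I_- φ (u) = ∫_u^∞ φ(v) dv`. -/
def integ : Side → (ℝ → ℝ) → ℝ → ℝ
  | .plus, φ => fun u => ∫ v in Set.Iic u, φ v
  | .minus, φ => fun u => ∫ v in Set.Ici u, φ v

/-- The iterated integral `I_±^k φ`. -/
def iterInteg (σ : Side) (k : ℕ) (φ : ℝ → ℝ) : ℝ → ℝ := (integ σ)^[k] φ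

/-- `f` has `r` vanishing moments of order `n`. -/
def HasVanishingMoments (n r : ℕ) (f : ℝ → ℝ) : Prop :=
  ∀ k : ℕ, 1 ≤ k → k ≤ n → ∀ m : ℕ, m < k * r →
    ∫ t : ℝ, f (t ^ k) * t ^ m = 0 ∧ ∫ t : ℝ, f (-t ^ k) * t ^ m = 0

/-- `τ = g ⊗ h` with Schwartz functions `g`, `h` such that `g` has `r` vanishing moments of
order `n`. -/
def IsAnalyzingTaylorlet (n r : ℕ) (τ : 𝓢(ℝ × ℝ, ℝ)) : Prop :=
  ∃ g h : 𝓢(ℝ, ℝ), (∀ x : ℝ × ℝ, τ x = g x.1 * h x.2) ∧ HasVanishingMoments n r g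

/-- `τ = g ⊗ h` is an analyzing Taylorlet of order `n` with `r` vanishing moments that is
restrictive: `I_+^i g (0) ≠ 0` for `i = 0, …, r`, and `∫ h ≠ 0`. -/
def IsRestrictiveTaylorlet (n r : ℕ) (τ : 𝓢(ℝ × ℝ, ℝ)) : Prop :=
  ∃ g h : 𝓢(ℝ, ℝ), (∀ x : ℝ × ℝ, τ x = g x.1 * h x.2) ∧ HasVanishingMoments n r g ∧
    (∀ i : ℕ, i ≤ r → iterInteg .plus i g 0 ≠ 0) ∧ ∫ u : ℝ, h u ≠ 0

/-- The shearing operator `S_s^{(n)}` of order `n`, for `s = (s_0, …, s_n)`. -/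
def shear {n : ℕ} (s : Fin (n + 1) → ℝ) (x : ℝ × ℝ) : ℝ × ℝ :=
  (x.1 + ∑ l : Fin (n + 1), s l / (Nat.factorial l : ℝ) * x.2 ^ (l : ℕ), x.2)

/-- The `α`-scaling matrix `diag (a, a ^ α)`. -/
def scaling (α a : ℝ) (x : ℝ × ℝ) : ℝ × ℝ := (a * x.1, a ^ α * x.2)

/-- The change of variables `x ↦ A_{1/a}^{(α)} S_{-s}^{(n)} (x₁, x₂ - t)`. -/
def coordChange {n : ℕ} (α a : ℝ) (s : Fin (n + 1) → ℝ) (t : ℝ) (x : ℝ × ℝ) : ℝ × ℝ :=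
  scaling α (1 / a) (shear (-s) (x.1, x.2 - t))

theorem hasTemperateGrowth_fst : Function.HasTemperateGrowth (fun x : ℝ × ℝ => x.1) :=
  (ContinuousLinearMap.fst ℝ ℝ ℝ).hasTemperateGrowth

theorem hasTemperateGrowth_snd : Function.HasTemperateGrowth (fun x : ℝ × ℝ => x.2) :=
  (ContinuousLinearMap.snd ℝ ℝ ℝ).hasTemperateGrowth

theorem hasTemperateGrowth_pair {f g : ℝ × ℝ → ℝ} (hf : f.HasTemperateGrowth)
    (hg : g.HasTemperateGrowth) : Function.HasTemperateGrowth (fun x => (f x, g x)) := by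
  have h1 := (ContinuousLinearMap.inl ℝ ℝ ℝ).hasTemperateGrowth.comp hf
  have h2 := (ContinuousLinearMap.inr ℝ ℝ ℝ).hasTemperateGrowth.comp hg
  have h := h1.add h2
  convert h using 1
  ext x <;> simp

theorem hasTemperateGrowth_coordChange {n : ℕ} (α a : ℝ) (s : Fin (n + 1) → ℝ) (t : ℝ) :
    (coordChange α a s t).HasTemperateGrowth := by
  have h1 := hasTemperateGrowth_fst
  have h2 := hasTemperateGrowth_snd
  unfold coordChange scaling shear
  apply hasTemperateGrowth_pair <;> fun_prop

theorem coordChange_upper {n : ℕ} (α a : ℝ) (ha : 0 < a) (s : Fin (n + 1) → ℝ) (t : ℝ) :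
    ∃ (k : ℕ) (C : ℝ), ∀ x, ‖x‖ ≤ C * (1 + ‖coordChange α a s t x‖) ^ k := by
  have h1 := hasTemperateGrowth_fst
  have h2 := hasTemperateGrowth_snd
  let ψ : ℝ × ℝ → ℝ × ℝ := fun y =>
    (a * y.1 + ∑ l : Fin (n + 1), s l / (Nat.factorial l : ℝ) * (a ^ α * y.2) ^ (l : ℕ),
      a ^ α * y.2 + t)
  have hψ : ψ.HasTemperateGrowth := by
    apply hasTemperateGrowth_pair <;> fun_prop
  obtain ⟨k, C, hC⟩ := hψ.2 0
  refine ⟨k, C, fun x => ?_⟩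
  have hinv : ψ (coordChange α a s t x) = x := by
    have e : a ^ α * ((1 / a) ^ α * (x.2 - t)) = x.2 - t := by
      rw [← mul_assoc, ← Real.mul_rpow ha.le (by positivity), mul_one_div_cancel ha.ne',
        Real.one_rpow, one_mul]
    ext
    · simp only [ψ, coordChange, scaling, shear, e, Pi.neg_apply, neg_div, neg_mul,
        Finset.sum_neg_distrib]
      rw [← mul_assoc, mul_one_div_cancel ha.ne']
      ring
    · simp only [ψ, coordChange, scaling, shear, e]
      ring
  have := hC (coordChange α a s t x)
  rwa [norm_iteratedFDeriv_zero, hinv] at this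

open Classical in
/-- The Schwartz function
`τ_{a,s,t}^{(n,α)} (x) = a ^ (-(1+α)/2) * τ (A_{1/a}^{(α)} S_{-s}^{(n)} (x₁, x₂ - t))` for `a > 0`;
the value for `a ≤ 0` is irrelevant. -/
def dilate {n : ℕ} (α : ℝ) (τ : 𝓢(ℝ × ℝ, ℝ)) (a : ℝ) (s : Fin (n + 1) → ℝ) (t : ℝ) :
    𝓢(ℝ × ℝ, ℝ) :=
  if ha : 0 < a then
    a ^ (-(1 + α) / 2) • SchwartzMap.compCLM ℝ (hasTemperateGrowth_coordChange α a s t)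
      (coordChange_upper α a ha s t) τ
  else 0

theorem dilate_apply {n : ℕ} (α : ℝ) (τ : 𝓢(ℝ × ℝ, ℝ)) {a : ℝ} (ha : 0 < a)
    (s : Fin (n + 1) → ℝ) (t : ℝ) (x : ℝ × ℝ) :
    dilate α τ a s t x = a ^ (-(1 + α) / 2) * τ (coordChange α a s t x) := by
  simp [dilate, ha]

/-- The Taylorlet transform `T^{(n,α)} f (a,s,t) = ⟨f, τ_{a,s,t}^{(n,α)}⟩` of a functional `f` on
the Schwartz space, in particular of a tempered distribution. -/
def transform {n : ℕ} (α : ℝ) (τ : 𝓢(ℝ × ℝ, ℝ)) (f : 𝓢(ℝ × ℝ, ℝ) → ℝ) (a : ℝ)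
    (s : Fin (n + 1) → ℝ) (t : ℝ) : ℝ :=
  f (dilate α τ a s t)

/-- The function `I_±^1 δ`, that is, `u ↦ H(±u)` with the Heaviside function `H`. -/
def heaviside : Side → ℝ → ℝ
  | .plus => Set.indicator (Set.Ioi 0) 1
  | .minus => Set.indicator (Set.Iio 0) 1

/-- The functional `f = I_±^j δ (x₁ - q(x₂))`: for `j = 0` it is `δ (x₁ - q(x₂))`, that is,
integration over the graph of `q` with respect to `x₂`; for `j ≥ 1` it is integration against the
function `x ↦ (I_±^{j-1} H_±) (x₁ - q(x₂))`, first in `x₁` and then in `x₂`. -/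
def feasible (σ : Side) (q : ℝ → ℝ) : ℕ → 𝓢(ℝ × ℝ, ℝ) → ℝ
  | 0, φ => ∫ x₂ : ℝ, φ (q x₂, x₂)
  | j + 1, φ => ∫ x₂ : ℝ, ∫ x₁ : ℝ, iterInteg σ j (heaviside σ) (x₁ - q x₂) * φ (x₁, x₂)

/-- The integrals in the definition of `feasible σ q j φ` converge. -/
def FeasibleConverges (σ : Side) (q : ℝ → ℝ) : ℕ → 𝓢(ℝ × ℝ, ℝ) → Prop
  | 0, φ => Integrable fun x₂ : ℝ => φ (q x₂, x₂)
  | j + 1, φ =>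
    (∀ x₂ : ℝ, Integrable fun x₁ : ℝ =>
      iterInteg σ j (heaviside σ) (x₁ - q x₂) * φ (x₁, x₂)) ∧
    Integrable fun x₂ : ℝ =>
      ∫ x₁ : ℝ, iterInteg σ j (heaviside σ) (x₁ - q x₂) * φ (x₁, x₂)

/-- `k` is the highest approximation order of `s = (s_0, …, s_n)` in `t` for the singularity
function `q`: `s_l = q^{(l)}(t)` for all `l ≤ k` and, if `k < n`, `s_{k+1} ≠ q^{(k+1)}(t)`. -/
def IsHighestApproxOrder {n : ℕ} (q : ℝ → ℝ) (s : Fin (n + 1) → ℝ) (t : ℝ) (k : ℕ) : Prop :=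
  k ≤ n ∧ (∀ l : Fin (n + 1), (l : ℕ) ≤ k → s l = iteratedDeriv l q t) ∧
    ∀ l : Fin (n + 1), (l : ℕ) = k + 1 → s l ≠ iteratedDeriv l q t

end Taylorlet

end

/-! Put G = I_+^j g and let Q(x) = q(t+x) - Σ s_l x^l / l! (`defect`). Moving the j integrations
from f onto g by Cauchy's formula and rescaling x₂ turns the transform into ± a^{j+(α-1)/2} ∫
G(Q(a^α y)/a) h(y) dy (`feasibleConverges_and_transform_eq`). Each integration uses up one of the r
vanishing moments and, because the total integral vanishes, preserves rapid decay; so G decays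
rapidly and keeps r-j vanishing moments (`rapidDecay_iterInteg`). The rest depends only on the order
of the zero of Q at 0.

If Q(0) ≠ 0, the argument of G has size at least of order 1/a while a^α y is small, and h is
negligible elsewhere (`isBigO_integral_of_ne_zero`). If Q vanishes to order at least n+1 > 1/α, the
argument of G tends to 0 and dominated convergence gives the limit G(0) ∫ h
(`tendsto_integral_of_eq_pow_mul`).

The main case is a zero of exact order K = k+1 ≤ n (`isBigO_integral_of_moments`). Near 0 there is a
smooth coordinate w with Q = ±w^K. With b = a^{1/K}, the substitution w = bv turns ∫ G(Q/a) w^m w'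
dx into a truncated moment of G(±v^K), negligible for m < M = K(r-j). A smooth function is a
combination of the densities w^m w', m < M, up to O(x^M). Taylor expansion of h(a^{-α}x) to order M
costs at most a^{-αM}, against a gain of b^M, and (a^{1/K-α})^M = a^{(r-j)(1-Kα)}. -/

noncomputable section

namespace Taylorlet

/-! ### Rapidly decaying functions and their primitives -/

/-- Continuous functions decaying faster than every power. -/
structure RapidDecay (f : ℝ → ℝ) : Prop where
  cont : Continuous f
  decay : ∀ N : ℕ, ∃ C : ℝ, ∀ u, (1 + |u|) ^ N * |f u| ≤ C

theorem _root_.SchwartzMap.rapidDecay (f : 𝓢(ℝ, ℝ)) : RapidDecay f := by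
  refine ⟨f.continuous, fun N => ⟨2 ^ N * (Finset.Iic (N, 0)).sup
    (fun m => SchwartzMap.seminorm ℝ m.1 m.2) f, fun u => ?_⟩⟩
  simpa using SchwartzMap.one_add_le_sup_seminorm_apply (𝕜 := ℝ) (m := (N, 0)) (le_refl N)
    (le_refl 0) f u

theorem one_add_abs_le {K : ℕ} (hK : 1 ≤ K) {c : ℝ} (hc : 0 < c) {u v : ℝ}
    (h : c * |v| ^ K ≤ |u|) : 1 + |v| ≤ (2 + c⁻¹) * (1 + |u|) := by
  have h1 : |v| ^ K ≤ c⁻¹ * |u| := by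
    rw [le_inv_mul_iff₀ hc]; exact h
  have h2 : |v| ≤ 1 + |v| ^ K := by
    rcases le_total |v| 1 with h | h
    · have : 0 ≤ |v| ^ K := by positivity
      linarith
    · have := le_self_pow₀ h (by omega : K ≠ 0)
      linarith
  have : 0 < c⁻¹ := by positivity
  nlinarith [abs_nonneg u]

namespace RapidDecay

variable {f : ℝ → ℝ}

/-- Decay in u is traded for decay in v wherever |u| dominates |v|^K. This serves both f(±t^K) and G
along a phase with a zero of order K. -/
theorem exists_bound_of_le (hf : RapidDecay f) {K : ℕ} (hK : 1 ≤ K) {c : ℝ} (hc : 0 < c)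
    (N : ℕ) : ∃ C, 0 < C ∧ ∀ u v : ℝ, c * |v| ^ K ≤ |u| → (1 + |v|) ^ N * |f u| ≤ C := by
  obtain ⟨C, hC⟩ := hf.decay N
  refine ⟨(2 + c⁻¹) ^ N * max C 1, by positivity, fun u v h => ?_⟩
  have h1 := one_add_abs_le hK hc h
  calc (1 + |v|) ^ N * |f u| ≤ ((2 + c⁻¹) * (1 + |u|)) ^ N * |f u| := by gcongr
    _ = (2 + c⁻¹) ^ N * ((1 + |u|) ^ N * |f u|) := by rw [mul_pow, mul_assoc]
    _ ≤ _ := by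
      gcongr
      exact (hC u).trans (le_max_left _ _)

theorem exists_pos_bound (hf : RapidDecay f) (N : ℕ) :
    ∃ C, 0 < C ∧ ∀ u : ℝ, (1 + |u|) ^ N * |f u| ≤ C := by
  obtain ⟨C, hC⟩ := hf.decay N
  exact ⟨max C 1, by positivity, fun u => (hC u).trans (le_max_left _ _)⟩

theorem exists_abs_le (hf : RapidDecay f) : ∃ C, 0 < C ∧ ∀ u : ℝ, |f u| ≤ C := by
  simpa using hf.exists_pos_bound 0

/-- Pointwise decay with an integrable majorant. -/
theorem exists_abs_le_inv (hf : RapidDecay f) (N : ℕ) :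
    ∃ C, 0 < C ∧ ∀ u : ℝ, (1 + |u|) ^ N * |f u| ≤ C * (1 + u ^ 2)⁻¹ := by
  obtain ⟨C, hC0, hC⟩ := hf.exists_pos_bound (N + 2)
  refine ⟨C, hC0, fun u => ?_⟩
  rw [← div_eq_mul_inv, le_div_iff₀ (by positivity)]
  refine le_trans ?_ (hC u)
  rw [pow_add, mul_right_comm]
  gcongr
  nlinarith [abs_nonneg u, sq_abs u]

theorem integrable (hf : RapidDecay f) : Integrable f := by
  obtain ⟨C, -, hC⟩ := hf.exists_abs_le_inv 0
  refine (integrable_inv_one_add_sq.const_mul C).mono' hf.cont.aestronglyMeasurable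
    (ae_of_all _ fun u => ?_)
  simpa using hC u

theorem mul_monomial (hf : RapidDecay f) (m : ℕ) : RapidDecay fun u => f u * u ^ m := by
  refine ⟨hf.cont.mul (continuous_pow m), fun N => ?_⟩
  obtain ⟨C, hC⟩ := hf.decay (N + m)
  refine ⟨C, fun u => le_trans ?_ (hC u)⟩
  rw [abs_mul, abs_pow, pow_add, mul_assoc, mul_comm |f u|]
  gcongr
  linarith

theorem comp_mul_pow (hf : RapidDecay f) {ε : ℝ} (hε : |ε| = 1) {K : ℕ} (hK : 1 ≤ K) :
    RapidDecay fun t => f (ε * t ^ K) := by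
  refine ⟨hf.cont.comp (by fun_prop), fun N => ?_⟩
  obtain ⟨C, -, hC⟩ := hf.exists_bound_of_le hK one_pos N
  refine ⟨C, fun u => hC _ _ ?_⟩
  rw [abs_mul, hε, abs_pow]

theorem tendsto_atTop (hf : RapidDecay f) : Tendsto f atTop (𝓝 0) := by
  obtain ⟨C, hC0, hC⟩ := hf.exists_pos_bound 1
  have h1 : Tendsto (fun u : ℝ => C / u) atTop (𝓝 0) := tendsto_const_nhds.div_atTop tendsto_id
  refine squeeze_zero_norm' ?_ h1
  filter_upwards [eventually_gt_atTop 0] with u hu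
  rw [le_div_iff₀ hu, Real.norm_eq_abs]
  have := hC u
  rw [abs_of_pos hu] at this
  nlinarith [abs_nonneg (f u)]

theorem comp_neg (hf : RapidDecay f) : RapidDecay fun t => f (-t) := by
  simpa using hf.comp_mul_pow (ε := -1) (by simp) le_rfl

theorem tendsto_atBot (hf : RapidDecay f) : Tendsto f atBot (𝓝 0) := by
  simpa [Function.comp_def] using hf.comp_neg.tendsto_atTop.comp tendsto_neg_atBot_atTop

/-- The weight at u is at most the weight at v on S, so it moves under the integral. With S a
half-line pointing away from 0, decay passes from f to its primitive. -/
theorem abs_setIntegral_le {N : ℕ} {C : ℝ} {S : Set ℝ} {u : ℝ} (hS : MeasurableSet S)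
    (hC : ∀ v : ℝ, (1 + |v|) ^ N * |f v| ≤ C * (1 + v ^ 2)⁻¹) (hSu : ∀ v ∈ S, |u| ≤ |v|)
    (hC0 : 0 < C) : (1 + |u|) ^ N * |∫ v in S, f v| ≤ C * Real.pi := by
  rw [← integral_univ_inv_one_add_sq, ← integral_const_mul, ← abs_of_pos
    (show 0 < (1 + |u|) ^ N by positivity), ← abs_mul, ← integral_const_mul,
    ← integral_indicator hS]
  refine norm_integral_le_of_norm_le (f := S.indicator fun v => (1 + |u|) ^ N * f v)
    (integrable_inv_one_add_sq.const_mul C) (ae_of_all _ fun v => ?_)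
  by_cases hv : v ∈ S
  · rw [Set.indicator_of_mem hv, norm_mul, Real.norm_eq_abs, Real.norm_eq_abs, abs_pow]
    refine le_trans ?_ (hC v)
    have := hSu v hv
    rw [abs_of_pos (show 0 < 1 + |u| by positivity)]
    gcongr
  · rw [Set.indicator_of_notMem hv]
    simp only [norm_zero]
    positivity

theorem hasDerivAt_integ (hf : RapidDecay f) (u : ℝ) : HasDerivAt (integ .plus f) (f u) u := by
  have h1 : integ .plus f = fun u => integ .plus f 0 + ∫ v in (0 : ℝ)..u, f v := by
    ext u
    have := intervalIntegral.integral_Iic_sub_Iic (a := 0) (b := u) hf.integrable.integrableOn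
      hf.integrable.integrableOn
    simp only [integ]
    linarith
  rw [h1]
  exact (intervalIntegral.integral_hasDerivAt_right (hf.cont.intervalIntegrable _ _)
    (hf.cont.stronglyMeasurableAtFilter _ _) hf.cont.continuousAt).const_add _

theorem setIntegral_Ioi (hf : RapidDecay f) (h0 : ∫ v, f v = 0) (u : ℝ) :
    ∫ v in Set.Ioi u, f v = -integ .plus f u := by
  have := intervalIntegral.integral_Iic_add_Ioi (b := u) hf.integrable.integrableOn
    hf.integrable.integrableOn
  simp only [integ]
  linarith

/-- For u ≤ 0 the half-line (-∞, u] already points away from 0. For u ≥ 0 the vanishing total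
integral allows replacing it by (u, ∞), up to sign. -/
theorem integ_plus (hf : RapidDecay f) (h0 : ∫ v, f v = 0) : RapidDecay (integ .plus f) := by
  refine ⟨continuous_iff_continuousAt.2 fun u => (hf.hasDerivAt_integ u).continuousAt,
    fun N => ?_⟩
  obtain ⟨C, hC0, hC⟩ := hf.exists_abs_le_inv N
  refine ⟨C * Real.pi, fun u => ?_⟩
  rcases le_total u 0 with hu | hu
  · refine abs_setIntegral_le measurableSet_Iic hC (fun v hv => ?_) hC0
    have : v ≤ u := hv
    rw [abs_of_nonpos hu, abs_of_nonpos (this.trans hu)]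
    linarith
  · rw [← abs_neg (integ .plus f u), ← hf.setIntegral_Ioi h0]
    refine abs_setIntegral_le measurableSet_Ioi hC (fun v hv => ?_) hC0
    have : u < v := hv
    rw [abs_of_nonneg hu, abs_of_nonneg (hu.trans this.le)]
    exact this.le

end RapidDecay

/-! ### Vanishing moments under integration -/

/-- With F = I_+ f, the derivative of F(εt^k) t^{m+1} is a combination of f(εt^k) t^{m+k} and
F(εt^k) t^m, and it integrates to zero. The shift from m to m+k is exactly one unit of r in the
range m < kr. -/
theorem integral_comp_eq_zero_of_moments {f : ℝ → ℝ} (hf : RapidDecay f) (h0 : ∫ v, f v = 0)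
    {ε : ℝ} (hε : |ε| = 1) {k m : ℕ} (hk : 1 ≤ k)
    (h : ∫ t, f (ε * t ^ k) * t ^ (m + k) = 0) :
    ∫ t, integ .plus f (ε * t ^ k) * t ^ m = 0 := by
  have hF := hf.integ_plus h0
  have hd : ∀ t : ℝ, HasDerivAt (fun t => integ .plus f (ε * t ^ k) * t ^ (m + 1))
      (ε * k * (f (ε * t ^ k) * t ^ (m + k)) +
        (m + 1) * (integ .plus f (ε * t ^ k) * t ^ m)) t := by
    intro t
    have h1 := ((hf.hasDerivAt_integ (ε * t ^ k)).comp t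
      ((hasDerivAt_pow k t).const_mul ε)).mul (hasDerivAt_pow (m + 1) t)
    refine h1.congr_deriv ?_
    obtain ⟨l, rfl⟩ : ∃ l, k = l + 1 := ⟨k - 1, by omega⟩
    simp only [Function.comp_apply, add_tsub_cancel_right]
    push_cast
    ring
  have i1 := ((hf.comp_mul_pow hε hk).mul_monomial (m + k)).integrable
  have i2 := ((hF.comp_mul_pow hε hk).mul_monomial m).integrable
  have i3 := ((hF.comp_mul_pow hε hk).mul_monomial (m + 1)).integrable
  have := integral_eq_zero_of_hasDerivAt_of_integrable hd
    ((i1.const_mul _).add (i2.const_mul _)) i3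
  rw [integral_add (i1.const_mul _) (i2.const_mul _), integral_const_mul, integral_const_mul, h,
    mul_zero, zero_add] at this
  exact (mul_eq_zero.1 this).resolve_left (by positivity)

theorem HasVanishingMoments.integral_eq_zero {n r : ℕ} {f : ℝ → ℝ} (hn : 1 ≤ n)
    (h : HasVanishingMoments n (r + 1) f) : ∫ v, f v = 0 := by
  simpa using (h 1 le_rfl hn 0 (by omega)).1

theorem HasVanishingMoments.integ_plus {n r : ℕ} {f : ℝ → ℝ} (hn : 1 ≤ n) (hf : RapidDecay f)
    (h : HasVanishingMoments n (r + 1) f) : HasVanishingMoments n r (integ .plus f) := by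
  intro k hk hkn m hm
  have h0 := h.integral_eq_zero hn
  have h1 := h k hk hkn (m + k) (by rw [mul_add]; omega)
  constructor
  · simpa using integral_comp_eq_zero_of_moments (m := m) hf h0 (ε := 1) (by simp) hk
      (by simpa using h1.1)
  · simpa using integral_comp_eq_zero_of_moments (m := m) hf h0 (ε := -1) (by simp) hk
      (by simpa using h1.2)

theorem iterInteg_succ (σ : Side) (j : ℕ) (f : ℝ → ℝ) :
    iterInteg σ (j + 1) f = iterInteg σ j (integ σ f) := rfl

theorem iterInteg_succ' (σ : Side) (j : ℕ) (f : ℝ → ℝ) :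
    iterInteg σ (j + 1) f = integ σ (iterInteg σ j f) :=
  Function.iterate_succ_apply' _ _ _

theorem rapidDecay_iterInteg {n : ℕ} (hn : 1 ≤ n) (j : ℕ) : ∀ {r : ℕ} {f : ℝ → ℝ},
    RapidDecay f → HasVanishingMoments n (r + j) f →
      RapidDecay (iterInteg .plus j f) ∧ HasVanishingMoments n r (iterInteg .plus j f) := by
  induction j with
  | zero => intro r f hf h; exact ⟨hf, h⟩
  | succ j ih =>
    intro r f hf h
    rw [iterInteg_succ]
    rw [← add_assoc] at h
    exact ih (hf.integ_plus (h.integral_eq_zero hn)) (h.integ_plus hn hf)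

/-! ### The kernels and repeated integration -/

/-- The kernel `I_±^j H(± ·)` in closed form. -/
theorem iterInteg_heaviside_plus (j : ℕ) : iterInteg .plus j (heaviside .plus) =
    (Set.Ioi 0).indicator fun u => u ^ j / (j.factorial : ℝ) := by
  induction j with
  | zero => ext u; simp [iterInteg, heaviside, Set.indicator]
  | succ j ih =>
    rw [iterInteg_succ', ih]
    ext u
    simp only [integ]
    rw [setIntegral_indicator measurableSet_Ioi, Set.inter_comm, Set.Ioi_inter_Iic]
    rcases le_or_gt u 0 with hu | hu
    · rw [Set.Ioc_eq_empty (by simpa using hu), Set.indicator_of_notMem (by simpa using hu)]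
      simp
    · rw [Set.indicator_of_mem (by simpa using hu), ← intervalIntegral.integral_of_le hu.le,
        intervalIntegral.integral_div, integral_pow, Nat.factorial_succ]
      push_cast
      field_simp
      simp

theorem iterInteg_heaviside_minus (j : ℕ) : iterInteg .minus j (heaviside .minus) =
    (Set.Iio 0).indicator fun u => (-u) ^ j / (j.factorial : ℝ) := by
  induction j with
  | zero => ext u; simp [iterInteg, heaviside, Set.indicator]
  | succ j ih =>
    rw [iterInteg_succ', ih]
    ext u
    simp only [integ]
    rw [setIntegral_indicator measurableSet_Iio, Set.Ici_inter_Iio]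
    rcases le_or_gt 0 u with hu | hu
    · rw [Set.Ico_eq_empty (by simpa using hu), Set.indicator_of_notMem (by simpa using hu)]
      simp
    · rw [Set.indicator_of_mem (by simpa using hu), integral_Ico_eq_integral_Ioc,
        ← intervalIntegral.integral_of_le hu.le,
        intervalIntegral.integral_div, intervalIntegral.integral_comp_neg (fun x => x ^ j),
        integral_pow, Nat.factorial_succ]
      push_cast
      field_simp
      simp

/-- Truncated powers are homogeneous. With the Jacobian of the x₁-scaling, this is the source of the
factor a^{j+1} for I_±^{j+1} δ. -/
theorem iterInteg_heaviside_mul (σ : Side) (j : ℕ) {a : ℝ} (ha : 0 < a) (u : ℝ) :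
    iterInteg σ j (heaviside σ) (a * u) = a ^ j * iterInteg σ j (heaviside σ) u := by
  cases σ
  · rw [iterInteg_heaviside_plus]
    by_cases hu : 0 < u
    · rw [Set.indicator_of_mem (by simpa using mul_pos ha hu),
        Set.indicator_of_mem (by simpa using hu)]
      ring
    · rw [Set.indicator_of_notMem (by simpa [mul_pos_iff_of_pos_left ha] using hu),
        Set.indicator_of_notMem (by simpa using hu), mul_zero]
  · rw [iterInteg_heaviside_minus]
    by_cases hu : u < 0
    · rw [Set.indicator_of_mem (by simpa using mul_neg_of_pos_of_neg ha hu),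
        Set.indicator_of_mem (by simpa using hu)]
      ring
    · rw [Set.indicator_of_notMem (by simpa using mul_nonneg ha.le (not_lt.1 hu)),
        Set.indicator_of_notMem (by simpa using hu), mul_zero]

theorem measurable_iterInteg_heaviside (σ : Side) (j : ℕ) :
    Measurable (iterInteg σ j (heaviside σ)) := by
  cases σ
  · rw [iterInteg_heaviside_plus]
    exact Measurable.indicator (by fun_prop) measurableSet_Ioi
  · rw [iterInteg_heaviside_minus]
    exact Measurable.indicator (by fun_prop) measurableSet_Iio

theorem abs_iterInteg_heaviside_le (σ : Side) (j : ℕ) (u : ℝ) :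
    |iterInteg σ j (heaviside σ) u| ≤ |u| ^ j := by
  have h (v : ℝ) : |v ^ j / (j.factorial : ℝ)| ≤ |v| ^ j := by
    rw [abs_div, abs_pow, Nat.abs_cast]
    exact div_le_self (by positivity)
      (by exact_mod_cast Nat.one_le_iff_ne_zero.2 j.factorial_ne_zero)
  cases σ
  · rw [iterInteg_heaviside_plus]
    refine (norm_indicator_le_norm_self (E := ℝ) _ u).trans (h u)
  · rw [iterInteg_heaviside_minus]
    refine (norm_indicator_le_norm_self (E := ℝ) _ u).trans ?_
    simpa only [abs_neg, Real.norm_eq_abs] using h (-u)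

theorem RapidDecay.integrable_heaviside_mul {f : ℝ → ℝ} (hf : RapidDecay f) (σ : Side) (j : ℕ)
    (u : ℝ) : Integrable fun y => iterInteg σ j (heaviside σ) (y - u) * f y := by
  obtain ⟨C, hC0, hC⟩ := hf.exists_abs_le_inv j
  refine (integrable_inv_one_add_sq.const_mul ((1 + |u|) ^ j * C)).mono'
    (((measurable_iterInteg_heaviside σ j).comp (by fun_prop)).mul
      hf.cont.measurable).aestronglyMeasurable (ae_of_all _ fun y => ?_)
  rw [norm_mul, mul_assoc]
  calc _ ≤ |y - u| ^ j * |f y| := by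
        gcongr
        exacts [abs_iterInteg_heaviside_le σ j _, le_rfl]
    _ ≤ ((1 + |u|) * (1 + |y|)) ^ j * |f y| := by
        gcongr
        have := abs_sub y u
        nlinarith [abs_nonneg y, abs_nonneg u]
    _ = (1 + |u|) ^ j * ((1 + |y|) ^ j * |f y|) := by rw [mul_pow, mul_assoc]
    _ ≤ _ := by grw [hC y]

/-- Polynomials times rapidly decaying functions. -/
theorem RapidDecay.mul_sub_pow {f : ℝ → ℝ} (hf : RapidDecay f) (u : ℝ) (m : ℕ) :
    RapidDecay fun y => (y - u) ^ m * f y := by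
  refine ⟨Continuous.mul (by fun_prop) hf.cont, fun N => ?_⟩
  obtain ⟨C, hC⟩ := hf.decay (N + m)
  refine ⟨(1 + |u|) ^ m * C, fun y => ?_⟩
  calc (1 + |y|) ^ N * |(y - u) ^ m * f y| = (1 + |y|) ^ N * (|y - u| ^ m * |f y|) := by
        rw [abs_mul, abs_pow]
    _ ≤ (1 + |y|) ^ N * (((1 + |u|) * (1 + |y|)) ^ m * |f y|) := by
        gcongr
        have := abs_sub y u
        nlinarith [abs_nonneg y, abs_nonneg u]
    _ = (1 + |u|) ^ m * ((1 + |y|) ^ (N + m) * |f y|) := by rw [mul_pow]; ring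
    _ ≤ _ := by gcongr; exact hC y

theorem hasDerivAt_sub_pow_mul_integ {f : ℝ → ℝ} (hf : RapidDecay f) (u : ℝ) (j : ℕ) (y : ℝ) :
    HasDerivAt (fun y => (y - u) ^ (j + 1) * integ .plus f y)
      ((j + 1) * ((y - u) ^ j * integ .plus f y) + (y - u) ^ (j + 1) * f y) y := by
  have h1 := (((hasDerivAt_id y).sub_const u).pow (j + 1)).mul (hf.hasDerivAt_integ y)
  refine h1.congr_deriv ?_
  simp
  ring

/-- Integration by parts: the boundary term at u is killed by the power of y - u, the one at
infinity by the decay of I_+ f, which relies on ∫ f = 0. -/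
theorem setIntegral_Ioi_sub_pow_succ {f : ℝ → ℝ} (hf : RapidDecay f) (h0 : ∫ v, f v = 0)
    (u : ℝ) (j : ℕ) : ∫ y in Set.Ioi u, (y - u) ^ (j + 1) * f y =
      -((j + 1) * ∫ y in Set.Ioi u, (y - u) ^ j * integ .plus f y) := by
  have hF := hf.integ_plus h0
  have i1 := (hF.mul_sub_pow u j).integrable.integrableOn (s := Set.Ioi u)
  have i2 := (hf.mul_sub_pow u (j + 1)).integrable.integrableOn (s := Set.Ioi u)
  have := integral_Ioi_of_hasDerivAt_of_tendsto' (a := u)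
    (fun y _ => hasDerivAt_sub_pow_mul_integ hf u j y)
    ((i1.const_mul _).add i2) (hF.mul_sub_pow u (j + 1)).tendsto_atTop
  rw [integral_add (i1.const_mul _) i2, integral_const_mul] at this
  simp at this
  linarith

theorem setIntegral_Iio_sub_pow_succ {f : ℝ → ℝ} (hf : RapidDecay f) (h0 : ∫ v, f v = 0)
    (u : ℝ) (j : ℕ) : ∫ y in Set.Iio u, (y - u) ^ (j + 1) * f y =
      -((j + 1) * ∫ y in Set.Iio u, (y - u) ^ j * integ .plus f y) := by
  have hF := hf.integ_plus h0
  have i1 := (hF.mul_sub_pow u j).integrable.integrableOn (s := Set.Iic u)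
  have i2 := (hf.mul_sub_pow u (j + 1)).integrable.integrableOn (s := Set.Iic u)
  have := integral_Iic_of_hasDerivAt_of_tendsto' (a := u)
    (fun y _ => hasDerivAt_sub_pow_mul_integ hf u j y)
    ((i1.const_mul _).add i2) (hF.mul_sub_pow u (j + 1)).tendsto_atBot
  rw [integral_add (i1.const_mul _) i2, integral_const_mul] at this
  simp at this
  rw [← integral_Iic_eq_integral_Iio, ← integral_Iic_eq_integral_Iio]
  linarith

/-- The sign relating integration against `I_±^j δ` to `I_+^j`. -/
def Side.sign : Side → ℝ
  | .plus => -1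
  | .minus => 1

theorem Side.sign_ne_zero (σ : Side) : σ.sign ≠ 0 := by cases σ <;> simp [Side.sign]

/-- Cauchy's formula for repeated integration. -/
theorem integral_heaviside_mul {n : ℕ} (hn : 1 ≤ n) (σ : Side) (j : ℕ) : ∀ {r : ℕ} {f : ℝ → ℝ},
    RapidDecay f → HasVanishingMoments n (r + j + 1) f → ∀ u : ℝ,
    ∫ y, iterInteg σ j (heaviside σ) (y - u) * f y =
      σ.sign ^ (j + 1) * iterInteg .plus (j + 1) f u := by
  have key (j : ℕ) (f : ℝ → ℝ) (u : ℝ) :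
      ∫ y, iterInteg σ j (heaviside σ) (y - u) * f y =
        match σ with
        | .plus => ((j.factorial : ℝ)⁻¹ * ∫ y in Set.Ioi u, (y - u) ^ j * f y)
        | .minus => ((-1) ^ j * (j.factorial : ℝ)⁻¹ * ∫ y in Set.Iio u, (y - u) ^ j * f y) := by
    cases σ <;> dsimp only
    · rw [iterInteg_heaviside_plus, ← integral_indicator measurableSet_Ioi, ← integral_const_mul]
      refine integral_congr_ae (ae_of_all _ fun y => ?_)
      beta_reduce
      by_cases hy : u < y
      · rw [Set.indicator_of_mem (by simpa using hy), Set.indicator_of_mem (by simpa using hy)]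
        ring
      · rw [Set.indicator_of_notMem (by simpa using hy),
          Set.indicator_of_notMem (by simpa using hy)]
        simp
    · rw [iterInteg_heaviside_minus, ← integral_indicator measurableSet_Iio, ← integral_const_mul]
      refine integral_congr_ae (ae_of_all _ fun y => ?_)
      beta_reduce
      by_cases hy : y < u
      · rw [Set.indicator_of_mem (by simpa using hy), Set.indicator_of_mem (by simpa using hy),
          neg_pow]
        ring
      · rw [Set.indicator_of_notMem (by simpa using hy),
          Set.indicator_of_notMem (by simpa using hy)]
        simp
  induction j with
  | zero =>
    intro r f hf h u
    rw [key]
    cases σ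
    · simp [Side.sign, iterInteg, hf.setIntegral_Ioi (h.integral_eq_zero hn)]
    · simp [Side.sign, iterInteg, integ, integral_Iic_eq_integral_Iio]
  | succ j ih =>
    intro r f hf h u
    have h0 := h.integral_eq_zero hn
    -- One power of the kernel is traded for one integration of f. Each trade gives a factor -1,
    -- which for the minus side cancels against the (-1)^j in its kernel.
    have := ih (hf.integ_plus h0) (h.integ_plus hn hf) u
    rw [iterInteg_succ .plus, pow_succ', mul_assoc, ← this, key, key]
    cases σ
    · simp only [setIntegral_Ioi_sub_pow_succ hf h0, Nat.factorial_succ, Side.sign]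
      push_cast
      field_simp
    · simp only [setIntegral_Iio_sub_pow_succ hf h0, Nat.factorial_succ, Side.sign]
      push_cast
      field_simp
      ring

/-! ### Taylor's formula with smooth remainder -/

theorem hasDerivAt_integral_comp_mul {κ f : ℝ → ℝ} (hκ : Continuous κ) (hf : ContDiff ℝ ∞ f)
    (x : ℝ) : HasDerivAt (fun x => ∫ s in (0 : ℝ)..1, κ s * f (s * x))
      (∫ s in (0 : ℝ)..1, (κ s * s) * deriv f (s * x)) x := by
  have hf' : Continuous (deriv f) := hf.continuous_deriv (by simp)
  have hfc := hf.continuous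
  obtain ⟨C, hC⟩ := (isCompact_Icc (a := (0 : ℝ)) (b := 1)).prod
    (isCompact_closedBall x 1) |>.exists_bound_of_continuousOn
    (f := fun p : ℝ × ℝ => (κ p.1 * p.1) * deriv f (p.1 * p.2))
    (Continuous.continuousOn (by fun_prop))
  refine (intervalIntegral.hasDerivAt_integral_of_dominated_loc_of_deriv_le
    (F := fun x s => κ s * f (s * x)) (F' := fun x s => (κ s * s) * deriv f (s * x))
    (bound := fun _ => C) (Metric.closedBall_mem_nhds x one_pos) ?_ ?_ ?_ ?_ ?_ ?_).2
  · exact Eventually.of_forall fun y =>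
      Continuous.aestronglyMeasurable (by fun_prop)
  · exact Continuous.intervalIntegrable (by fun_prop) _ _
  · exact Continuous.aestronglyMeasurable (by fun_prop)
  · refine ae_of_all _ fun s hs y hy => hC (s, y) ⟨?_, hy⟩
    rw [Set.uIoc_of_le zero_le_one] at hs
    exact ⟨hs.1.le, hs.2⟩
  · exact intervalIntegrable_const
  · refine ae_of_all _ fun s _ y _ => ?_
    have h1 : HasDerivAt f (deriv f (s * y)) (s * y) :=
      (hf.differentiable (by simp) (s * y)).hasDerivAt
    refine ((h1.comp y ((hasDerivAt_id y).const_mul s)).const_mul (κ s)).congr_deriv ?_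
    ring

theorem contDiff_integral_comp_mul {κ f : ℝ → ℝ} (hκ : Continuous κ) (hf : ContDiff ℝ ∞ f) :
    ContDiff ℝ ∞ fun x => ∫ s in (0 : ℝ)..1, κ s * f (s * x) := by
  rw [contDiff_infty]
  intro N
  -- Differentiation replaces κ(s) by κ(s)s and f by f', so both must vary in the induction.
  induction N generalizing κ f with
  | zero =>
    have := hf.continuous
    rw [Nat.cast_zero, contDiff_zero]
    exact intervalIntegral.continuous_parametric_intervalIntegral_of_continuous' (by fun_prop) _ _
  | succ N ih =>
    have hd := hasDerivAt_integral_comp_mul hκ hf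
    rw [Nat.cast_add, Nat.cast_one, contDiff_succ_iff_deriv]
    refine ⟨fun x => (hd x).differentiableAt, by simp, ?_⟩
    rw [funext fun x => (hd x).deriv]
    exact ih (hκ.mul continuous_id) (contDiff_infty_iff_deriv.1 hf).2

/-- Integration by parts in s, which splits one Taylor coefficient off the integral remainder. -/
theorem integral_comp_mul_eq_add {f : ℝ → ℝ} (hf : ContDiff ℝ ∞ f) (M : ℕ) (x : ℝ) :
    ∫ s in (0 : ℝ)..1, (1 - s) ^ M / (M.factorial : ℝ) * f (s * x) =
      f 0 / ((M + 1).factorial : ℝ) + x * ∫ s in (0 : ℝ)..1,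
        (1 - s) ^ (M + 1) / ((M + 1).factorial : ℝ) * deriv f (s * x) := by
  have hf' : Continuous (deriv f) := hf.continuous_deriv (by simp)
  have hfc := hf.continuous
  have hd (s : ℝ) : HasDerivAt (fun s => (1 - s) ^ (M + 1) / ((M + 1).factorial : ℝ) * f (s * x))
      (-((1 - s) ^ M / (M.factorial : ℝ) * f (s * x)) +
        x * ((1 - s) ^ (M + 1) / ((M + 1).factorial : ℝ) * deriv f (s * x))) s := by
    have h1 : HasDerivAt f (deriv f (s * x)) (s * x) :=
      (hf.differentiable (by simp) (s * x)).hasDerivAt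
    have h2 := ((((hasDerivAt_id s).const_sub 1).pow (M + 1)).div_const
      ((M + 1).factorial : ℝ)).mul (h1.comp s ((hasDerivAt_id s).mul_const x))
    refine h2.congr_deriv ?_
    simp only [Nat.factorial_succ, id, Function.comp_apply, Pi.pow_apply,
      add_tsub_cancel_right]
    push_cast
    field_simp
  have i1 : IntervalIntegrable (fun s : ℝ => (1 - s) ^ M / (M.factorial : ℝ) * f (s * x))
    volume 0 1 := Continuous.intervalIntegrable (by fun_prop) _ _
  have i2 : IntervalIntegrable (fun s : ℝ => (1 - s) ^ (M + 1) / ((M + 1).factorial : ℝ) *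
    deriv f (s * x)) volume 0 1 := Continuous.intervalIntegrable (by fun_prop) _ _
  have := intervalIntegral.integral_eq_sub_of_hasDerivAt (a := 0) (b := 1) (fun s _ => hd s)
    (i1.neg.add (i2.const_mul x))
  rw [intervalIntegral.integral_add (by exact i1.neg) (i2.const_mul x),
    intervalIntegral.integral_neg,
    intervalIntegral.integral_const_mul] at this
  simp only [sub_self, zero_mul, sub_zero, one_pow] at this
  rw [zero_pow (by omega), zero_div, zero_mul] at this
  linarith [one_div_mul_eq_div ((M + 1).factorial : ℝ) (f 0)]

/-- Taylor's formula with a smooth remainder. -/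
theorem exists_taylor_smooth_remainder {f : ℝ → ℝ} (hf : ContDiff ℝ ∞ f) (N : ℕ) :
    ∃ R : ℝ → ℝ, ContDiff ℝ ∞ R ∧ R 0 = iteratedDeriv N f 0 / (N.factorial : ℝ) ∧
      ∀ x, f x = ∑ l ∈ Finset.range N, iteratedDeriv l f 0 / (l.factorial : ℝ) * x ^ l +
        x ^ N * R x := by
  have hs (N : ℕ) : ContDiff ℝ ∞ (iteratedDeriv N f) :=
    iteratedDeriv_eq_iterate (n := N) (f := f) ▸ hf.iterate_deriv N
  -- Order zero is separate, since the integral remainder involves at least one derivative.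
  rcases N with _ | N
  · exact ⟨f, hf, by simp, by simp⟩
  refine ⟨fun x => ∫ s in (0 : ℝ)..1, (1 - s) ^ N / (N.factorial : ℝ) *
    iteratedDeriv (N + 1) f (s * x), contDiff_integral_comp_mul (by fun_prop) (hs _), ?_, ?_⟩
  · beta_reduce
    rw [integral_comp_mul_eq_add (hs _)]
    simp
  · induction N with
    | zero =>
      intro x
      have hd (s : ℝ) : HasDerivAt (fun s => f (s * x)) (x * deriv f (s * x)) s := by
        have h1 : HasDerivAt f (deriv f (s * x)) (s * x) :=
          (hf.differentiable (by simp) (s * x)).hasDerivAt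
        refine (h1.comp s ((hasDerivAt_id s).mul_const x)).congr_deriv (by ring)
      have hf' : Continuous (deriv f) := hf.continuous_deriv (by simp)
      have := intervalIntegral.integral_eq_sub_of_hasDerivAt (a := 0) (b := 1)
        (fun s _ => hd s) (Continuous.intervalIntegrable (by fun_prop) _ _)
      rw [intervalIntegral.integral_const_mul] at this
      simp only [one_mul, zero_mul] at this
      simp [this]
    | succ N ih =>
      intro x
      rw [ih x]
      beta_reduce
      rw [integral_comp_mul_eq_add (hs _), Finset.sum_range_succ _ (N + 1)]
      simp only [← iteratedDeriv_succ]
      ring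

/-! ### The defect and reduction to a one-dimensional integral -/

/-- The difference between the singularity function and the shear polynomial. -/
def defect {n : ℕ} (q : ℝ → ℝ) (s : Fin (n + 1) → ℝ) (t x : ℝ) : ℝ :=
  q (t + x) - ∑ l : Fin (n + 1), s l / (Nat.factorial l : ℝ) * x ^ (l : ℕ)

theorem contDiff_defect {n : ℕ} {q : ℝ → ℝ} (hq : ContDiff ℝ ∞ q) (s : Fin (n + 1) → ℝ)
    (t : ℝ) : ContDiff ℝ ∞ (defect q s t) := by
  unfold defect
  fun_prop

theorem defect_zero {n : ℕ} (q : ℝ → ℝ) (s : Fin (n + 1) → ℝ) (t : ℝ) :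
    defect q s t 0 = q t - s 0 := by
  simp [defect, Fin.sum_univ_succ]

/-- The Taylor terms of q up to degree k cancel; the shear terms of higher degree are divisible by
x^{k+1} and go into R. For k = n the claim about R(0) is vacuous. -/
theorem exists_defect_eq_pow_mul {n : ℕ} {q : ℝ → ℝ} (hq : ContDiff ℝ ∞ q)
    (s : Fin (n + 1) → ℝ) (t : ℝ) {k : ℕ} (hk : k ≤ n)
    (hs : ∀ l : Fin (n + 1), (l : ℕ) ≤ k → s l = iteratedDeriv l q t) :
    ∃ R : ℝ → ℝ, ContDiff ℝ ∞ R ∧ (∀ x, defect q s t x = x ^ (k + 1) * R x) ∧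
      ∀ l : Fin (n + 1), (l : ℕ) = k + 1 →
        R 0 = (iteratedDeriv l q t - s l) / ((k + 1).factorial : ℝ) := by
  have hq' : ContDiff ℝ ∞ fun x => q (t + x) := by fun_prop
  obtain ⟨R, hR, hR0, hRq⟩ := exists_taylor_smooth_remainder hq' (k + 1)
  simp only [iteratedDeriv_comp_const_add, add_zero] at hR0 hRq
  -- Extension of s by zero, so that the sum over `Fin (n + 1)` becomes a range sum that can be cut
  -- at k+1.
  let S : ℕ → ℝ := fun l => if h : l < n + 1 then s ⟨l, h⟩ else 0
  have hS (l : Fin (n + 1)) : S l = s l := dif_pos l.2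
  refine ⟨fun x => R x - ∑ i ∈ Finset.range (n - k),
    S (k + 1 + i) / ((k + 1 + i).factorial : ℝ) * x ^ i, by fun_prop, fun x => ?_, fun l hl => ?_⟩
  · rw [defect, hRq]
    simp only [← hS]
    rw [Fin.sum_univ_eq_sum_range (fun l => S l / (l.factorial : ℝ) * x ^ l),
      show n + 1 = k + 1 + (n - k) by omega,
      Finset.sum_range_add (fun l => S l / (l.factorial : ℝ) * x ^ l), mul_sub, Finset.mul_sum]
    have h1 : ∑ l ∈ Finset.range (k + 1), iteratedDeriv l q t / (l.factorial : ℝ) * x ^ l =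
        ∑ l ∈ Finset.range (k + 1), S l / (l.factorial : ℝ) * x ^ l := by
      refine Finset.sum_congr rfl fun l hl => ?_
      rw [Finset.mem_range] at hl
      have := hs ⟨l, by omega⟩ (by simp; omega)
      rw [← hS] at this
      simp only at this
      rw [this]
    have h2 : ∑ i ∈ Finset.range (n - k), x ^ (k + 1) * (S (k + 1 + i) /
        ((k + 1 + i).factorial : ℝ) * x ^ i) = ∑ i ∈ Finset.range (n - k),
        S (k + 1 + i) / ((k + 1 + i).factorial : ℝ) * x ^ (k + 1 + i) :=
      Finset.sum_congr rfl fun i _ => by rw [pow_add]; ring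
    rw [h1, h2]
    ring
  · obtain ⟨m, hm⟩ : ∃ m, n - k = m + 1 := ⟨n - k - 1, by omega⟩
    beta_reduce
    rw [hR0, hm, Finset.sum_range_succ']
    simp only [add_zero, pow_zero, mul_one, ← hS l, hl]
    rw [Finset.sum_eq_zero (fun i _ => by simp)]
    ring

theorem integrable_comp_mul_sub {F : ℝ → ℝ} (hF : Integrable F) {c : ℝ} (hc : 0 < c) (t : ℝ) :
    Integrable fun x => F (c * (x - t)) :=
  (hF.comp_mul_left' hc.ne').comp_sub_right t

theorem integral_comp_mul_sub (F : ℝ → ℝ) {c : ℝ} (hc : 0 < c) (t : ℝ) :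
    ∫ x, F (c * (x - t)) = c⁻¹ * ∫ x, F x := by
  rw [integral_sub_right_eq_self (fun x => F (c * x)) t, Measure.integral_comp_mul_left,
    abs_of_pos (by positivity), smul_eq_mul]

theorem RapidDecay.integrable_comp_mul {G H Q : ℝ → ℝ} (hG : RapidDecay G) (hQ : Continuous Q)
    (hH : RapidDecay H) : Integrable fun y => G (Q y) * H y := by
  obtain ⟨C, -, hC⟩ := hG.exists_abs_le
  exact hH.integrable.bdd_mul (hG.cont.comp hQ).aestronglyMeasurable (ae_of_all _ fun y => hC _)

theorem dilate_mk {n : ℕ} {τ : 𝓢(ℝ × ℝ, ℝ)} {g h : ℝ → ℝ}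
    (hτ : ∀ x : ℝ × ℝ, τ x = g x.1 * h x.2) (α : ℝ) {a : ℝ} (ha : 0 < a)
    (s : Fin (n + 1) → ℝ) (t : ℝ) (x₁ x₂ : ℝ) :
    dilate α τ a s t (x₁, x₂) = a ^ (-(1 + α) / 2) *
      (g (a⁻¹ * (x₁ - ∑ l : Fin (n + 1), s l / (Nat.factorial l : ℝ) * (x₂ - t) ^ (l : ℕ))) *
        h (a⁻¹ ^ α * (x₂ - t))) := by
  rw [dilate_apply α τ ha, hτ]
  simp only [coordChange, scaling, shear, Pi.neg_apply, neg_div, neg_mul, Finset.sum_neg_distrib,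
    one_div, sub_eq_add_neg]

theorem heaviside_mul_dilated {n r j : ℕ} (hn : 1 ≤ n) {g : ℝ → ℝ} (hg : RapidDecay g)
    (hgm : HasVanishingMoments n (r + j + 1) g) (σ : Side) {a : ℝ} (ha : 0 < a) (A H c p : ℝ) :
    (Integrable fun x => iterInteg σ j (heaviside σ) (x - c) * (A * (g (a⁻¹ * (x - p)) * H))) ∧
    ∫ x, iterInteg σ j (heaviside σ) (x - c) * (A * (g (a⁻¹ * (x - p)) * H)) =
      A * a ^ (j + 1) * σ.sign ^ (j + 1) * (iterInteg .plus (j + 1) g ((c - p) / a) * H) := by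
  have e (x : ℝ) : iterInteg σ j (heaviside σ) (x - c) * (A * (g (a⁻¹ * (x - p)) * H)) =
      A * H * a ^ j * (fun y => iterInteg σ j (heaviside σ) (y - (c - p) / a) * g y)
        (a⁻¹ * (x - p)) := by
    have : x - c = a * (a⁻¹ * (x - p) - (c - p) / a) := by
      field_simp
      ring
    rw [this, iterInteg_heaviside_mul σ j ha]
    ring
  simp_rw [e]
  refine ⟨(integrable_comp_mul_sub (hg.integrable_heaviside_mul σ j _) (inv_pos.2 ha) p).const_mul
    _, ?_⟩
  rw [integral_const_mul, integral_comp_mul_sub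
    (fun y => iterInteg σ j (heaviside σ) (y - (c - p) / a) * g y) (inv_pos.2 ha),
    integral_heaviside_mul hn σ j hg hgm, inv_inv]
  ring

/-- For j = 0 restriction to the graph gives F at once; for j ≥ 1 the inner integral is evaluated by
Cauchy's formula for each x₂. Convergence and value thus both rest on F. -/
theorem feasible_dilate_eq_integral {n r j : ℕ} (hn : 1 ≤ n) (hj : j < r)
    {τ : 𝓢(ℝ × ℝ, ℝ)} {g h : ℝ → ℝ}
    (hg : RapidDecay g) (hτ : ∀ x : ℝ × ℝ, τ x = g x.1 * h x.2)
    (hgm : HasVanishingMoments n r g) (σ : Side) (q : ℝ → ℝ) (α : ℝ) {a : ℝ} (ha : 0 < a)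
    (s : Fin (n + 1) → ℝ) (t : ℝ) (F : ℝ → ℝ)
    (hF : F = fun x₂ => a ^ (-(1 + α) / 2) * a ^ j * σ.sign ^ j *
      (iterInteg .plus j g (defect q s t (x₂ - t) / a) * h (a⁻¹ ^ α * (x₂ - t)))) :
    (FeasibleConverges σ q j (dilate α τ a s t) ↔ Integrable F) ∧
      feasible σ q j (dilate α τ a s t) = ∫ x, F x := by
  have hd (x₂ : ℝ) : defect q s t (x₂ - t) =
      q x₂ - ∑ l : Fin (n + 1), s l / (Nat.factorial l : ℝ) * (x₂ - t) ^ (l : ℕ) := by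
    simp [defect]
  subst hF
  rcases j with _ | j
  · simp only [FeasibleConverges, feasible, dilate_mk hτ α ha, ← hd, iterInteg,
      Function.iterate_zero, id, pow_zero, mul_one, inv_mul_eq_div, and_self]
  · obtain ⟨r, rfl⟩ := Nat.exists_eq_add_of_le' hj.le
    have := fun x₂ : ℝ => heaviside_mul_dilated (r := r) hn hg hgm σ ha
      (a ^ (-(1 + α) / 2)) (h (a⁻¹ ^ α * (x₂ - t))) (q x₂)
      (∑ l : Fin (n + 1), s l / (Nat.factorial l : ℝ) * (x₂ - t) ^ (l : ℕ))
    simp only [← hd] at this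
    simp only [FeasibleConverges, feasible, dilate_mk hτ α ha, fun x => (this x).2,
      fun x => (this x).1, implies_true, true_and, and_self]

/-- Substitution x₂ = t + a^α y. The exponent collects -(1+α)/2 from the normalization, j from the
integrations and α from the Jacobian. -/
theorem feasibleConverges_and_transform_eq {n r j : ℕ} (hn : 1 ≤ n) (hj : j < r)
    {τ : 𝓢(ℝ × ℝ, ℝ)} {g h : ℝ → ℝ} (hg : RapidDecay g) (hh : RapidDecay h)
    (hτ : ∀ x : ℝ × ℝ, τ x = g x.1 * h x.2) (hgm : HasVanishingMoments n r g) (σ : Side)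
    {q : ℝ → ℝ} (hq : ContDiff ℝ ∞ q) (α : ℝ) {a : ℝ} (ha : 0 < a)
    (s : Fin (n + 1) → ℝ) (t : ℝ) :
    FeasibleConverges σ q j (dilate α τ a s t) ∧
      transform α τ (feasible σ q j) a s t = a ^ ((j : ℝ) + (α - 1) / 2) * (σ.sign ^ j *
        ∫ y, iterInteg .plus j g (defect q s t (a ^ α * y) / a) * h y) := by
  obtain ⟨r', rfl⟩ := Nat.exists_eq_add_of_le' hj.le
  have hG := (rapidDecay_iterInteg hn j hg hgm).1
  have hQ := (contDiff_defect hq s t).continuous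
  have ha' : 0 < a⁻¹ ^ α := by positivity
  have haa : (a⁻¹ ^ α)⁻¹ = a ^ α := by rw [Real.inv_rpow ha.le, inv_inv]
  have e (x : ℝ) : a ^ α * (a⁻¹ ^ α * (x - t)) = x - t := by
    rw [← haa, inv_mul_cancel_left₀ ha'.ne']
  have hi := hG.integrable_comp_mul (Q := fun y => defect q s t (a ^ α * y) / a) (by fun_prop) hh
  have h1 := integrable_comp_mul_sub hi ha' t
  have h2 := integral_comp_mul_sub
    (fun y => iterInteg .plus j g (defect q s t (a ^ α * y) / a) * h y) ha' t
  simp only [e] at h1 h2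
  obtain ⟨hc, hv⟩ := feasible_dilate_eq_integral hn hj hg hτ hgm σ q α ha s t _ rfl
  refine ⟨hc.2 (h1.const_mul _), ?_⟩
  have hexp : a ^ ((j : ℝ) + (α - 1) / 2) = a ^ (-(1 + α) / 2) * a ^ j * a ^ α := by
    rw [← Real.rpow_natCast, ← Real.rpow_add ha, ← Real.rpow_add ha]
    congr 1
    ring
  rw [transform, hv, integral_const_mul, h2, hexp, haa]
  ring

/-! ### No contact, and contact of high order -/

theorem RapidDecay.exists_tail_bound {H : ℝ → ℝ} (hH : RapidDecay H) {α δ : ℝ} (hα : 0 < α)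
    (hδ : 0 < δ) (N : ℕ) : ∃ C, 0 < C ∧ ∀ a, 0 < a → a ≤ 1 → ∀ y, δ < |a ^ α * y| →
      |H y| ≤ C * a ^ N * (1 + y ^ 2)⁻¹ := by
  -- Since |y| > δ a^{-α}, p powers of decay are worth a^{αp}, which is at most a^N once αp ≥ N.
  obtain ⟨p, hp⟩ := exists_nat_ge (N / α)
  obtain ⟨C, hC0, hC⟩ := hH.exists_abs_le_inv p
  refine ⟨C / δ ^ p, by positivity, fun a ha ha1 y hy => ?_⟩
  have haα : 0 < a ^ α := by positivity
  have h1 : δ / a ^ α ≤ 1 + |y| := by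
    rw [abs_mul, abs_of_pos haα] at hy
    rw [div_le_iff₀ haα]
    nlinarith
  have h2 : (a ^ α) ^ p ≤ a ^ N := by
    rw [← Real.rpow_natCast, ← Real.rpow_mul ha.le, ← Real.rpow_natCast a]
    refine Real.rpow_le_rpow_of_exponent_ge ha ha1 ?_
    rwa [div_le_iff₀' hα] at hp
  have h3 : (δ / a ^ α) ^ p * |H y| ≤ C * (1 + y ^ 2)⁻¹ := le_trans (by gcongr) (hC y)
  rw [div_pow, div_mul_eq_mul_div, div_le_iff₀ (by positivity)] at h3
  rw [div_mul_eq_mul_div, div_mul_eq_mul_div, le_div_iff₀ (by positivity)]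
  calc |H y| * δ ^ p ≤ C * (1 + y ^ 2)⁻¹ * (a ^ α) ^ p := by linarith
    _ ≤ C * (1 + y ^ 2)⁻¹ * a ^ N := by gcongr
    _ = _ := by ring

theorem isBigO_integral_of_le {F : ℝ → ℝ → ℝ} {C : ℝ} {b : ℝ → ℝ} (hb : ∀ a, 0 < a → 0 ≤ b a)
    (h : ∀ a, 0 < a → a ≤ 1 → ∀ y, |F a y| ≤ C * b a * (1 + y ^ 2)⁻¹) :
    (fun a => ∫ y, F a y) =O[𝓝[>] 0] b := by
  refine IsBigO.of_bound (C * Real.pi) ?_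
  filter_upwards [Ioc_mem_nhdsGT one_pos] with a ha
  have := norm_integral_le_of_norm_le (f := F a) (integrable_inv_one_add_sq.const_mul (C * b a))
    (ae_of_all _ fun y => h a ha.1 ha.2 y)
  rw [integral_const_mul, integral_univ_inv_one_add_sq] at this
  rw [Real.norm_of_nonneg (hb a ha.1)]
  linarith

theorem isBigO_integral_of_ne_zero {G H Q : ℝ → ℝ} (hG : RapidDecay G) (hH : RapidDecay H)
    (hQ : Continuous Q) (hQ0 : Q 0 ≠ 0) {α : ℝ} (hα : 0 < α) (N : ℕ) :
    (fun a : ℝ => ∫ y, G (Q (a ^ α * y) / a) * H y) =O[𝓝[>] 0] fun a => a ^ N := by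
  have h0 : 0 < |Q 0| / 2 := by positivity
  obtain ⟨δ, hδ, hQδ⟩ : ∃ δ > 0, ∀ x, |x| ≤ δ → |Q 0| / 2 ≤ |Q x| := by
    have : ∀ᶠ x in 𝓝 0, |Q 0| / 2 ≤ |Q x| :=
      (hQ.abs.tendsto 0).eventually (eventually_ge_nhds (by linarith))
    obtain ⟨δ, hδ, h⟩ := Metric.eventually_nhds_iff_ball.1 this
    refine ⟨δ / 2, by positivity, fun x hx => h x ?_⟩
    rw [mem_ball_zero_iff, Real.norm_eq_abs]
    linarith
  set c := |Q 0| / 2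
  obtain ⟨C₁, hC₁0, hC₁⟩ := hG.exists_pos_bound N
  obtain ⟨C₂, hC₂0, hC₂⟩ := hH.exists_abs_le_inv 0
  obtain ⟨C₃, hC₃0, hC₃⟩ := hH.exists_tail_bound hα hδ N
  obtain ⟨C₄, hC₄0, hC₄⟩ := hG.exists_abs_le
  refine isBigO_integral_of_le (C := C₁ / c ^ N * C₂ + C₄ * C₃) (fun a ha => by positivity)
    fun a ha ha1 y => ?_
  rw [abs_mul]
  rcases le_or_gt |a ^ α * y| δ with hy | hy
  · have h1 : c / a ≤ 1 + |Q (a ^ α * y) / a| := by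
      rw [abs_div, abs_of_pos ha]
      have : c / a ≤ |Q (a ^ α * y)| / a := by gcongr; exact hQδ _ hy
      linarith
    have h2 : (c / a) ^ N * |G (Q (a ^ α * y) / a)| ≤ C₁ := le_trans (by gcongr) (hC₁ _)
    rw [div_pow, div_mul_eq_mul_div, div_le_iff₀ (by positivity)] at h2
    have h3 : |G (Q (a ^ α * y) / a)| ≤ C₁ / c ^ N * a ^ N := by
      rw [div_mul_eq_mul_div, le_div_iff₀ (by positivity)]
      linarith
    calc _ ≤ (C₁ / c ^ N * a ^ N) * (C₂ * (1 + y ^ 2)⁻¹) := by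
          gcongr
          simpa using hC₂ y
      _ = C₁ / c ^ N * C₂ * a ^ N * (1 + y ^ 2)⁻¹ := by ring
      _ ≤ _ := by
          gcongr
          have : 0 < C₄ * C₃ := by positivity
          linarith
  · calc _ ≤ C₄ * (C₃ * a ^ N * (1 + y ^ 2)⁻¹) := by
          gcongr
          exacts [hC₄ _, hC₃ a ha ha1 y hy]
      _ = C₄ * C₃ * a ^ N * (1 + y ^ 2)⁻¹ := by ring
      _ ≤ _ := by
          gcongr
          have : 0 < C₁ / c ^ N * C₂ := by positivity
          linarith

/-- The argument of G equals a^{αm-1} y^m R(a^α y), which tends to 0; sup |G| times |H| is the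
majorant. -/
theorem tendsto_integral_of_eq_pow_mul {G H Q R : ℝ → ℝ} (hG : RapidDecay G) (hH : RapidDecay H)
    (hR : Continuous R) {m : ℕ} (hQR : ∀ x, Q x = x ^ m * R x) {α : ℝ} (hα : 0 < α)
    (hαm : 1 < α * m) :
    Tendsto (fun a : ℝ => ∫ y, G (Q (a ^ α * y) / a) * H y) (𝓝[>] 0) (𝓝 (G 0 * ∫ y, H y)) := by
  obtain ⟨C, -, hC⟩ := hG.exists_abs_le
  have hQ : Continuous Q := by
    rw [funext hQR]
    fun_prop
  rw [← integral_const_mul]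
  refine tendsto_integral_filter_of_dominated_convergence (fun y => C * |H y|) ?_ ?_
    (hH.integrable.abs.const_mul C) (ae_of_all _ fun y => ?_)
  · exact Eventually.of_forall fun a => (hG.integrable_comp_mul
      (Q := fun y => Q (a ^ α * y) / a) (by fun_prop) hH).aestronglyMeasurable
  · refine Eventually.of_forall fun a => ae_of_all _ fun y => ?_
    rw [norm_mul]
    exact mul_le_mul_of_nonneg_right (hC _) (norm_nonneg _)
  · refine Tendsto.mul_const _ ?_
    have h1 : Tendsto (fun a : ℝ => a ^ α) (𝓝[>] 0) (𝓝 0) := by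
      have := (Real.continuousAt_rpow_const 0 α (Or.inr hα.le)).tendsto
      rw [Real.zero_rpow hα.ne'] at this
      exact this.mono_left nhdsWithin_le_nhds
    have h2 : Tendsto (fun a : ℝ => a ^ (α * m - 1)) (𝓝[>] 0) (𝓝 0) := by
      have := (Real.continuousAt_rpow_const 0 (α * m - 1) (Or.inr (by linarith))).tendsto
      rw [Real.zero_rpow (by linarith)] at this
      exact this.mono_left nhdsWithin_le_nhds
    have h3 : Tendsto (fun a : ℝ => a ^ (α * m - 1) * (y ^ m * R (a ^ α * y))) (𝓝[>] 0)
        (𝓝 (0 * (y ^ m * R (0 * y)))) :=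
      h2.mul (((hR.tendsto _).comp (h1.mul_const y)).const_mul _)
    rw [zero_mul] at h3
    refine (hG.cont.tendsto 0).comp (h3.congr' ?_)
    filter_upwards [self_mem_nhdsWithin] with a ha
    have ha : 0 < a := ha
    rw [hQR, _root_.mul_pow, Real.rpow_sub ha, Real.rpow_mul ha.le, Real.rpow_natCast,
      Real.rpow_one]
    ring

/-! ### Contact of exact order K -/

/-- A smooth function vanishing to order exactly `K` at `0` is, up to a sign, locally the `K`-th
power of a coordinate. -/
theorem exists_pow_coordinate {R : ℝ → ℝ} (hR : ContDiff ℝ ∞ R) (hR0 : R 0 ≠ 0) {K : ℕ}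
    (hK : 1 ≤ K) : ∃ ε : ℝ, (ε = 1 ∨ ε = -1) ∧ ∃ ρ : ℝ → ℝ, ContDiff ℝ ∞ ρ ∧ (∀ x, 0 < ρ x) ∧
      ∃ δ > 0, ∀ x, |x| ≤ δ → x ^ K * R x = ε * (x * ρ x) ^ K := by
  obtain ⟨ε, hε, hpos⟩ : ∃ ε : ℝ, (ε = 1 ∨ ε = -1) ∧ 0 < ε * R 0 := by
    rcases lt_or_gt_of_ne hR0 with h | h
    · exact ⟨-1, Or.inr rfl, by linarith⟩
    · exact ⟨1, Or.inl rfl, by linarith⟩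
  have hεε : ε * ε = 1 := by rcases hε with rfl | rfl <;> norm_num
  refine ⟨ε, hε, ?_⟩
  have hcont : Continuous fun x => ε * R x := hR.continuous.const_mul ε
  obtain ⟨δ, hδ, hball⟩ := Metric.eventually_nhds_iff_ball.1
    ((hcont.tendsto 0).eventually (eventually_gt_nhds hpos))
  let χ : ContDiffBump (0 : ℝ) := ⟨δ / 2, δ, by positivity, by linarith⟩
  -- The cutoff interpolates between εR near 0 and the constant εR(0), so S is positive everywhere
  -- and its K-th root is smooth on the whole line.
  let S : ℝ → ℝ := fun x => χ x * (ε * R x) + (1 - χ x) * (ε * R 0)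
  have hS : ContDiff ℝ ∞ S := by
    have : ContDiff ℝ ∞ (χ : ℝ → ℝ) := χ.contDiff
    fun_prop
  have hSpos (x : ℝ) : 0 < S x := by
    by_cases hx : x ∈ Metric.ball (0 : ℝ) δ
    · have h1 := hball x hx
      have h2 := χ.nonneg (x := x)
      have h3 := χ.le_one (x := x)
      rcases h2.eq_or_lt with h2 | h2
      · simp only [S, ← h2]
        linarith
      · have := mul_pos h2 h1
        have := mul_nonneg (sub_nonneg.2 h3) hpos.le
        simp only [S]
        linarith
    · have : χ x = 0 := χ.zero_of_le_dist (by simpa using hx)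
      simp only [S, this]
      linarith
  refine ⟨fun x => S x ^ ((K : ℝ)⁻¹), hS.rpow_const_of_ne fun x => (hSpos x).ne',
    fun x => Real.rpow_pos_of_pos (hSpos x) _, δ / 2, by positivity, fun x hx => ?_⟩
  have h1 : χ x = 1 := χ.one_of_mem_closedBall (by simpa using hx)
  rw [mul_pow, Real.rpow_inv_natCast_pow (hSpos x).le (by omega)]
  simp only [S, h1]
  linear_combination (-(x ^ K * R x)) * hεε

/-- Expansion of a smooth function in the densities `w ^ m * w'` of a coordinate
`w = x * ρ x`. -/
theorem exists_coordinate_expansion {p ρ : ℝ → ℝ} (hp : ContDiff ℝ ∞ p) (hρ : ContDiff ℝ ∞ ρ)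
    (hρ0 : ρ 0 ≠ 0) (M : ℕ) : ∃ (c : ℕ → ℝ) (P : ℝ → ℝ), ContDiff ℝ ∞ P ∧
      ∀ x, p x = ∑ m ∈ Finset.range M, c m * ((x * ρ x) ^ m * deriv (fun x => x * ρ x) x) +
        x ^ M * P x := by
  have hw : ContDiff ℝ ∞ fun x => x * ρ x := by fun_prop
  have hw' : ContDiff ℝ ∞ (deriv fun x => x * ρ x) := (contDiff_infty_iff_deriv.1 hw).2
  have hw0 : deriv (fun x => x * ρ x) 0 = ρ 0 := by
    rw [deriv_fun_mul differentiableAt_fun_id (hρ.differentiable (by simp) 0)]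
    simp
  induction M with
  | zero => exact ⟨0, p, hp, by simp⟩
  | succ M ih =>
    obtain ⟨c, P, hP, hpP⟩ := ih
    -- Since w'(0) = ρ(0), the density w^M w' is x^M times a function with value ρ(0)^{M+1} at 0;
    -- this κ makes the new remainder divisible by a further x.
    let κ := P 0 / ρ 0 ^ (M + 1)
    obtain ⟨T, hT, -, hPT⟩ := exists_taylor_smooth_remainder
      (f := fun x => P x - κ * (ρ x ^ M * deriv (fun x => x * ρ x) x)) (by fun_prop) 1
    refine ⟨Function.update c M κ, T, hT, fun x => ?_⟩
    have h0 : P 0 - κ * (ρ 0 ^ M * deriv (fun x => x * ρ x) 0) = 0 := by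
      rw [hw0, ← pow_succ, div_mul_cancel₀ _ (pow_ne_zero _ hρ0), sub_self]
    have h1 := hPT x
    simp only [Finset.sum_range_one, iteratedDeriv_zero, h0, zero_div, zero_mul, zero_add,
      pow_one] at h1
    have h2 : ∀ m ∈ Finset.range M, c m * ((x * ρ x) ^ m * deriv (fun x => x * ρ x) x) =
        Function.update c M κ m * ((x * ρ x) ^ m * deriv (fun x => x * ρ x) x) := fun m hm => by
      rw [Function.update_of_ne (Finset.mem_range.1 hm).ne]
    rw [hpP x, Finset.sum_range_succ, Function.update_self, Finset.sum_congr rfl h2, mul_pow]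
    linear_combination x ^ M * h1

/-- The primitive of Φ decays rapidly because ∫ Φ = 0, and both endpoints recede to infinity like
1/b. -/
theorem RapidDecay.exists_interval_bound {Φ : ℝ → ℝ} (hΦ : RapidDecay Φ) (h0 : ∫ v, Φ v = 0)
    {A B : ℝ} (hA : A ≠ 0) (hB : B ≠ 0) (M : ℕ) :
    ∃ C, 0 ≤ C ∧ ∀ b, 0 < b → |∫ v in (A / b)..(B / b), Φ v| ≤ C * b ^ M := by
  obtain ⟨C, hC0, hC⟩ := (hΦ.integ_plus h0).exists_pos_bound M
  have key (D b : ℝ) (hD : D ≠ 0) (hb : 0 < b) :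
      |integ .plus Φ (D / b)| ≤ C / |D| ^ M * b ^ M := by
    have h1 : (|D| / b) ^ M * |integ .plus Φ (D / b)| ≤ C := by
      refine le_trans ?_ (hC (D / b))
      gcongr
      rw [abs_div, abs_of_pos hb]
      linarith
    rw [div_pow, div_mul_eq_mul_div, div_le_iff₀ (by positivity)] at h1
    rw [div_mul_eq_mul_div, le_div_iff₀ (by positivity)]
    linarith
  refine ⟨C / |B| ^ M + C / |A| ^ M, by positivity, fun b hb => ?_⟩
  rw [← intervalIntegral.integral_Iic_sub_Iic hΦ.integrable.integrableOn
    hΦ.integrable.integrableOn, add_mul]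
  exact (abs_sub _ _).trans (add_le_add (key B b hB hb) (key A b hA hb))

theorem integral_inv_one_add_sq_comp {b : ℝ} (hb : 0 < b) :
    ∫ x : ℝ, (1 + (b⁻¹ * x) ^ 2)⁻¹ = b * Real.pi := by
  rw [Measure.integral_comp_mul_left (fun x : ℝ => (1 + x ^ 2)⁻¹), integral_univ_inv_one_add_sq,
    inv_inv, abs_of_pos hb, smul_eq_mul]

/-- Controls the remainders of both expansions below. In the variable v = x/b the lower bound on Q
makes G decay rapidly in v; |x|^M contributes b^M and dx one more b. -/
theorem RapidDecay.exists_localized_bound {G Q : ℝ → ℝ} (hG : RapidDecay G) {K : ℕ} (hK : 1 ≤ K)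
    {c δ : ℝ} (hc : 0 < c) (hδ : 0 < δ) (hQ : ∀ x, |x| ≤ δ → c * |x| ^ K ≤ |Q x|) (M : ℕ) :
    ∃ C, 0 ≤ C ∧ ∀ (b : ℝ), 0 < b → ∀ (D : ℝ), 0 ≤ D → ∀ F : ℝ → ℝ,
      (∀ x, |x| ≤ δ → |F x| ≤ D * (|G (Q x / b ^ K)| * |x| ^ M)) →
      |∫ x in (-δ)..δ, F x| ≤ D * C * b ^ (M + 1) := by
  obtain ⟨C, hC0, hC⟩ := hG.exists_bound_of_le hK hc (M + 2)
  refine ⟨C * Real.pi, by positivity, fun b hb D hD F hF => ?_⟩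
  have key (x : ℝ) (hx : |x| ≤ δ) : |F x| ≤ D * C * b ^ M * (1 + (b⁻¹ * x) ^ 2)⁻¹ := by
    have h1 : c * |b⁻¹ * x| ^ K ≤ |Q x / b ^ K| := by
      rw [abs_div, abs_mul, abs_of_pos (inv_pos.2 hb), abs_of_pos (pow_pos hb K), mul_pow,
        inv_pow, le_div_iff₀ (by positivity)]
      calc _ = c * |x| ^ K := by field_simp
        _ ≤ _ := hQ x hx
    have h2 := hC _ _ h1
    set v := b⁻¹ * x with hv
    have hxv : x = b * v := by rw [hv, mul_inv_cancel_left₀ hb.ne']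
    refine (hF x hx).trans ?_
    rw [mul_assoc, mul_assoc]
    refine mul_le_mul_of_nonneg_left ?_ hD
    rw [← mul_assoc, ← div_eq_mul_inv, le_div_iff₀ (by positivity)]
    calc |G (Q x / b ^ K)| * |x| ^ M * (1 + v ^ 2)
        = b ^ M * (|v| ^ M * (1 + v ^ 2) * |G (Q x / b ^ K)|) := by
          rw [hxv, abs_mul, abs_of_pos hb, mul_pow]
          ring
      _ ≤ b ^ M * ((1 + |v|) ^ (M + 2) * |G (Q x / b ^ K)|) := by
          rw [pow_add]
          gcongr
          · linarith
          · nlinarith [abs_nonneg v, sq_abs v]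
      _ ≤ C * b ^ M := by
          rw [mul_comm C]
          gcongr
  rw [intervalIntegral.integral_of_le (by linarith), ← integral_indicator measurableSet_Ioc]
  have hint : Integrable fun x : ℝ => D * C * b ^ M * (1 + (b⁻¹ * x) ^ 2)⁻¹ :=
    (integrable_inv_one_add_sq.comp_mul_left' (inv_pos.2 hb).ne').const_mul _
  refine (norm_integral_le_of_norm_le (f := (Set.Ioc (-δ) δ).indicator F) hint
    (ae_of_all _ fun x => ?_)).trans_eq ?_
  · by_cases hx : x ∈ Set.Ioc (-δ) δ
    · rw [Set.indicator_of_mem hx]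
      exact key x (abs_le.2 ⟨hx.1.le, hx.2⟩)
    · rw [Set.indicator_of_notMem hx, norm_zero]
      positivity
  · rw [integral_const_mul, integral_inv_one_add_sq_comp hb]
    ring

/-- Vanishing moments make integrals of `G` along a smooth phase small to high order. -/
theorem exists_phase_integral_bound {G Q ρ p : ℝ → ℝ} (hG : RapidDecay G) (hQc : Continuous Q)
    (hρ : ContDiff ℝ ∞ ρ) (hρpos : ∀ x, 0 < ρ x) (hp : ContDiff ℝ ∞ p) {K M : ℕ} (hK : 1 ≤ K)
    {c ε δ : ℝ} (hc : 0 < c) (hε : |ε| = 1) (hδ : 0 < δ)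
    (hQ : ∀ x, |x| ≤ δ → Q x = ε * (x * ρ x) ^ K) (hQ' : ∀ x, |x| ≤ δ → c * |x| ^ K ≤ |Q x|)
    (hM : ∀ m < M, ∫ t, G (ε * t ^ K) * t ^ m = 0) :
    ∃ C, 0 ≤ C ∧ ∀ b, 0 < b → b ≤ 1 →
      |∫ x in (-δ)..δ, G (Q x / b ^ K) * p x| ≤ C * b ^ (M + 1) := by
  obtain ⟨e, P, hP, hpP⟩ := exists_coordinate_expansion hp hρ (hρpos 0).ne' M
  set w : ℝ → ℝ := fun x => x * ρ x with hw_def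
  have hw : ContDiff ℝ ∞ w := by fun_prop
  have hw' : Continuous (deriv w) := hw.continuous_deriv (by simp)
  have hwd (x : ℝ) : HasDerivAt w (deriv w x) x := (hw.differentiable (by simp) x).hasDerivAt
  have hGc := hG.cont
  have hwc := hw.continuous
  have hPc := hP.continuous
  have hmom : ∀ m < M, ∃ C, 0 ≤ C ∧ ∀ b, 0 < b → b ≤ 1 →
      |∫ x in (-δ)..δ, G (Q x / b ^ K) * (w x ^ m * deriv w x)| ≤ C * b ^ (M + 1) := by
    intro m hm
    have hΦ := (hG.comp_mul_pow hε hK).mul_monomial m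
    obtain ⟨C, hC0, hC⟩ := hΦ.exists_interval_bound (hM m hm) (A := w (-δ)) (B := w δ)
      (mul_ne_zero (by linarith) (hρpos _).ne') (mul_ne_zero hδ.ne' (hρpos _).ne') M
    refine ⟨C, hC0, fun b hb hb1 => ?_⟩
    -- Substitution v = w(x)/b, which produces a moment of G(εv^K) truncated at the images of ±δ.
    have h1 : ∫ x in (-δ)..δ, G (Q x / b ^ K) * (w x ^ m * deriv w x) =
        b ^ (m + 1) * ∫ v in (w (-δ) / b)..(w δ / b), G (ε * v ^ K) * v ^ m := by
      have h2 := intervalIntegral.integral_comp_mul_deriv (a := -δ) (b := δ)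
        (g := fun u => G (ε * (u / b) ^ K) * (u / b) ^ m) (fun x _ => hwd x) hw'.continuousOn
        (by fun_prop)
      rw [intervalIntegral.integral_comp_div (fun v => G (ε * v ^ K) * v ^ m) hb.ne'] at h2
      rw [pow_succ, mul_assoc, ← smul_eq_mul b, ← h2, ← intervalIntegral.integral_const_mul]
      refine intervalIntegral.integral_congr fun x hx => ?_
      rw [Set.uIcc_of_le (by linarith)] at hx
      simp only [Function.comp_apply, div_pow]
      rw [hQ x (abs_le.2 hx), mul_div_assoc]
      change G (ε * (w x ^ K / b ^ K)) * _ = _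
      field_simp
    rw [h1, abs_mul, abs_of_pos (by positivity)]
    -- Of b^{m+1} only one factor b is kept, as m may be 0; the truncated moment supplies b^M.
    calc b ^ (m + 1) * _ ≤ b ^ 1 * (C * b ^ M) := by
          gcongr ?_ * ?_
          · exact pow_le_pow_of_le_one hb.le hb1 (by omega)
          · exact hC b hb
      _ = C * b ^ (M + 1) := by ring
  choose! D hD0 hD using hmom
  obtain ⟨C, hC0, hC⟩ := hG.exists_localized_bound hK hc hδ hQ' M
  obtain ⟨E, hE⟩ := (isCompact_Icc (a := -δ) (b := δ)).exists_bound_of_continuousOn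
    hPc.continuousOn
  refine ⟨∑ m ∈ Finset.range M, |e m| * D m + |E| * C, add_nonneg (Finset.sum_nonneg fun m hm =>
    mul_nonneg (abs_nonneg _) (hD0 m (Finset.mem_range.1 hm))) (by positivity),
    fun b hb hb1 => ?_⟩
  have hi (m : ℕ) : IntervalIntegrable (fun x => e m * (G (Q x / b ^ K) *
      (w x ^ m * deriv w x))) volume (-δ) δ :=
    Continuous.intervalIntegrable (by fun_prop) _ _
  have hi' : IntervalIntegrable (fun x => G (Q x / b ^ K) * (x ^ M * P x)) volume (-δ) δ :=
    Continuous.intervalIntegrable (by fun_prop) _ _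
  have hsplit : ∫ x in (-δ)..δ, G (Q x / b ^ K) * p x =
      ∑ m ∈ Finset.range M, e m * (∫ x in (-δ)..δ, G (Q x / b ^ K) * (w x ^ m * deriv w x)) +
        ∫ x in (-δ)..δ, G (Q x / b ^ K) * (x ^ M * P x) := by
    simp_rw [← intervalIntegral.integral_const_mul]
    rw [← intervalIntegral.integral_finsetSum fun m _ => hi m,
      ← intervalIntegral.integral_add 
        (Continuous.intervalIntegrable (by fun_prop) _ _) hi']
    refine intervalIntegral.integral_congr fun x _ => ?_
    simp only [hpP x, mul_add, Finset.mul_sum]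
    congr 1
    exact Finset.sum_congr rfl fun m _ => by ring
  rw [hsplit, add_mul, Finset.sum_mul]
  refine (abs_add_le _ _).trans (add_le_add ((Finset.abs_sum_le_sum_abs _ _).trans
    (Finset.sum_le_sum fun m hm => ?_)) (hC b hb |E| (abs_nonneg _) _ fun x hx => ?_))
  · rw [abs_mul, mul_assoc]
    exact mul_le_mul_of_nonneg_left (hD m (Finset.mem_range.1 hm) b hb hb1) (abs_nonneg _)
  · rw [abs_mul, abs_mul, abs_pow]
    have : |P x| ≤ |E| := (hE x (abs_le.1 hx)).trans (le_abs_self _)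
    calc _ ≤ |G (Q x / b ^ K)| * (|x| ^ M * |E|) := by gcongr
      _ = _ := by ring

/-- The bound must be global, since it is used at dx with d unbounded. For |y| ≥ 1 both H and a
polynomial of degree below M are trivially O(|y|^M). -/
theorem exists_taylor_bound {H : ℝ → ℝ} (hH : ContDiff ℝ ∞ H) (hHd : RapidDecay H) (M : ℕ) :
    ∃ e : ℕ → ℝ, ∃ C, 0 ≤ C ∧ ∀ y, |H y - ∑ i ∈ Finset.range M, e i * y ^ i| ≤ C * |y| ^ M := by
  obtain ⟨R, hR, -, hHR⟩ := exists_taylor_smooth_remainder hH M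
  obtain ⟨C₁, hC₁⟩ := (isCompact_Icc (a := (-1 : ℝ)) (b := 1)).exists_bound_of_continuousOn
    hR.continuous.continuousOn
  obtain ⟨C₂, hC₂0, hC₂⟩ := hHd.exists_abs_le
  refine ⟨fun l => iteratedDeriv l H 0 / (l.factorial : ℝ), |C₁| + (C₂ + ∑ i ∈ Finset.range M,
    |iteratedDeriv i H 0 / (i.factorial : ℝ)|), by positivity, fun y => ?_⟩
  rw [add_mul]
  rcases le_total |y| 1 with hy | hy
  · rw [hHR y, add_sub_cancel_left, abs_mul, abs_pow, mul_comm]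
    have : |R y| ≤ |C₁| := (hC₁ y (abs_le.1 hy)).trans (le_abs_self _)
    have : |R y| * |y| ^ M ≤ |C₁| * |y| ^ M := by gcongr
    have : 0 ≤ (C₂ + ∑ i ∈ Finset.range M,
      |iteratedDeriv i H 0 / (i.factorial : ℝ)|) * |y| ^ M := by positivity
    linarith
  · have h1 : 1 ≤ |y| ^ M := one_le_pow₀ hy
    refine (abs_sub _ _).trans ?_
    have h2 : |∑ i ∈ Finset.range M, iteratedDeriv i H 0 / (i.factorial : ℝ) * y ^ i| ≤
        (∑ i ∈ Finset.range M, |iteratedDeriv i H 0 / (i.factorial : ℝ)|) * |y| ^ M := by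
      rw [Finset.sum_mul]
      refine (Finset.abs_sum_le_sum_abs _ _).trans (Finset.sum_le_sum fun i hi => ?_)
      rw [abs_mul, abs_pow]
      gcongr
      exact (Finset.mem_range.1 hi).le
    have h3 : |H y| ≤ C₂ * |y| ^ M := (hC₂ y).trans (le_mul_of_one_le_right hC₂0.le h1)
    have : 0 ≤ |C₁| * |y| ^ M := by positivity
    linarith

/-- The estimate for the part of the integral near the point of contact. -/
theorem exists_local_bound {G H Q ρ : ℝ → ℝ} (hG : RapidDecay G) (hH : ContDiff ℝ ∞ H)
    (hHd : RapidDecay H) (hQc : Continuous Q) (hρ : ContDiff ℝ ∞ ρ) (hρpos : ∀ x, 0 < ρ x)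
    {K M : ℕ} (hK : 1 ≤ K) {c ε δ : ℝ} (hc : 0 < c) (hε : |ε| = 1) (hδ : 0 < δ)
    (hQ : ∀ x, |x| ≤ δ → Q x = ε * (x * ρ x) ^ K) (hQ' : ∀ x, |x| ≤ δ → c * |x| ^ K ≤ |Q x|)
    (hM : ∀ m < M, ∫ t, G (ε * t ^ K) * t ^ m = 0) :
    ∃ C, 0 ≤ C ∧ ∀ b d, 0 < b → b ≤ 1 → 1 ≤ d →
      |∫ x in (-δ)..δ, G (Q x / b ^ K) * H (d * x)| ≤ C * (d ^ M * b ^ (M + 1)) := by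
  obtain ⟨e, E, hE0, hE⟩ := exists_taylor_bound hH hHd M
  obtain ⟨C, hC0, hC⟩ := hG.exists_localized_bound hK hc hδ hQ' M
  have hmono (i : ℕ) := exists_phase_integral_bound hG hQc hρ hρpos (p := fun x => x ^ i)
    (by fun_prop) hK hc hε hδ hQ hQ' hM
  choose D hD0 hD using hmono
  refine ⟨∑ i ∈ Finset.range M, |e i| * D i + E * C, add_nonneg (Finset.sum_nonneg fun i _ =>
    mul_nonneg (abs_nonneg _) (hD0 i)) (by positivity), fun b d hb hb1 hd => ?_⟩
  have hGc := hG.cont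
  have hHc := hH.continuous
  -- Taylor remainder of H: the monomials in dx cost d^i ≤ d^M and are handled by the moments, the
  -- remainder costs d^M |x|^M and is handled by localization.
  let rem : ℝ → ℝ := fun y => H y - ∑ i ∈ Finset.range M, e i * y ^ i
  have hi (i : ℕ) : IntervalIntegrable (fun x => (e i * d ^ i) * (G (Q x / b ^ K) * x ^ i))
      volume (-δ) δ := Continuous.intervalIntegrable (by fun_prop) _ _
  have hi' : IntervalIntegrable (fun x => G (Q x / b ^ K) * rem (d * x)) volume (-δ) δ :=
    Continuous.intervalIntegrable (by fun_prop) _ _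
  have hsplit : ∫ x in (-δ)..δ, G (Q x / b ^ K) * H (d * x) =
      ∑ i ∈ Finset.range M, (e i * d ^ i) * (∫ x in (-δ)..δ, G (Q x / b ^ K) * x ^ i) +
        ∫ x in (-δ)..δ, G (Q x / b ^ K) * rem (d * x) := by
    simp_rw [← intervalIntegral.integral_const_mul]
    rw [← intervalIntegral.integral_finsetSum fun i _ => hi i,
      ← intervalIntegral.integral_add
        (Continuous.intervalIntegrable (by fun_prop) _ _) hi']
    refine intervalIntegral.integral_congr fun x _ => ?_
    simp only [rem, mul_sub, Finset.mul_sum]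
    rw [← sub_eq_iff_eq_add', sub_right_inj]
    exact Finset.sum_congr rfl fun i _ => by ring
  rw [hsplit, add_mul, Finset.sum_mul]
  refine (abs_add_le _ _).trans (add_le_add ((Finset.abs_sum_le_sum_abs _ _).trans
    (Finset.sum_le_sum fun i hi => ?_)) ?_)
  · rw [abs_mul, abs_mul, abs_of_pos (show 0 < d ^ i by positivity)]
    calc |e i| * d ^ i * _ ≤ |e i| * d ^ M * (D i * b ^ (M + 1)) := by
          gcongr ?_ * ?_ * ?_
          · exact pow_le_pow_right₀ hd (Finset.mem_range.1 hi).le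
          · exact hD i b hb hb1
      _ = _ := by ring
  · refine (hC b hb (E * d ^ M) (by positivity) _ fun x _ => ?_).trans_eq (by ring)
    rw [abs_mul]
    have h1 : |rem (d * x)| ≤ E * (d ^ M * |x| ^ M) := by
      refine (hE (d * x)).trans_eq ?_
      rw [abs_mul, abs_of_pos (one_pos.trans_le hd), mul_pow]
    calc _ ≤ |G (Q x / b ^ K)| * (E * (d ^ M * |x| ^ M)) := by gcongr
      _ = _ := by ring

/-- With b = a^{1/K} and d = a^{-α}, the local bound d^M b^{M+1} and the Jacobian d of x = a^α y
combine to (db)^{M+1}, where db = a^{1/K-α}. The part away from 0 is negligible by the decay of H.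
-/
theorem isBigO_integral_of_moments {G H Q R : ℝ → ℝ} (hG : RapidDecay G) (hH : ContDiff ℝ ∞ H)
    (hHd : RapidDecay H) (hR : ContDiff ℝ ∞ R) (hR0 : R 0 ≠ 0) {K M : ℕ} (hK : 1 ≤ K)
    (hQR : ∀ x, Q x = x ^ K * R x)
    (hM : ∀ m < M, ∫ t, G (t ^ K) * t ^ m = 0 ∧ ∫ t, G (-t ^ K) * t ^ m = 0)
    {α : ℝ} (hα : 0 < α) (hαK : α * K < 1) :
    (fun a : ℝ => ∫ y, G (Q (a ^ α * y) / a) * H y) =O[𝓝[>] 0]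
      fun a => a ^ (((K : ℝ)⁻¹ - α) * M) := by
  have hQc : Continuous Q := by
    rw [funext hQR]
    have := hR.continuous
    fun_prop
  obtain ⟨ε, hε, ρ, hρ, hρpos, δ, hδ, hx⟩ := exists_pow_coordinate hR hR0 hK
  have hQ (x : ℝ) (h : |x| ≤ δ) : Q x = ε * (x * ρ x) ^ K := by rw [hQR, hx x h]
  have hε1 : |ε| = 1 := by rcases hε with rfl | rfl <;> simp
  have hM' : ∀ m < M, ∫ t, G (ε * t ^ K) * t ^ m = 0 := by
    rcases hε with rfl | rfl
    · simpa using fun m hm => (hM m hm).1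
    · simpa using fun m hm => (hM m hm).2
  -- The minimum of ρ on [-δ, δ] gives the constant in the lower bound for |Q|.
  obtain ⟨x₀, -, hx₀⟩ := (isCompact_Icc (a := -δ) (b := δ)).exists_isMinOn
    ⟨0, by simp [hδ.le]⟩ hρ.continuous.continuousOn
  have hQ' (x : ℝ) (h : |x| ≤ δ) : ρ x₀ ^ K * |x| ^ K ≤ |Q x| := by
    rw [hQ x h, abs_mul, hε1, one_mul, abs_pow, abs_mul, abs_of_pos (hρpos x), ← mul_pow,
      mul_comm]
    have := hρpos x₀
    gcongr
    exact isMinOn_iff.1 hx₀ x (abs_le.1 h)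
  obtain ⟨C, hC0, hC⟩ := exists_local_bound hG hH hHd hQc hρ hρpos hK
    (pow_pos (hρpos x₀) K) hε1 hδ hQ hQ' hM'
  obtain ⟨D, hD0, hD⟩ := hHd.exists_tail_bound hα hδ (M + 1)
  obtain ⟨B, hB0, hB⟩ := hG.exists_abs_le
  refine IsBigO.of_bound (C + B * D * Real.pi) ?_
  filter_upwards [Ioc_mem_nhdsGT one_pos] with a ⟨ha, ha1⟩
  have hK0 : (0 : ℝ) < K := by exact_mod_cast hK
  set b := a ^ ((K : ℝ)⁻¹) with hb_def
  set d := (a ^ α)⁻¹ with hd_def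
  have haα : 0 < a ^ α := by positivity
  have hb : 0 < b := by positivity
  have hb1 : b ≤ 1 := Real.rpow_le_one ha.le ha1 (by positivity)
  have hbK : b ^ K = a := Real.rpow_inv_natCast_pow ha.le (by omega)
  have hd1 : 1 ≤ d := (one_le_inv₀ haα).2 (Real.rpow_le_one ha.le ha1 hα.le)
  have hab : a ≤ b := by
    rw [← hbK]
    exact pow_le_of_le_one hb.le hb1 (by omega)
  have had (y : ℝ) : a ^ α * (d * y) = y := mul_inv_cancel_left₀ haα.ne' y
  have hGc := hG.cont
  have hi : Integrable fun x => G (Q x / a) * H (d * x) :=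
    hG.integrable_comp_mul (Q := fun x => Q x / a) (by fun_prop)
      (H := fun x => H (d * x)) ⟨by have := hHd.cont; fun_prop, fun N => by
        obtain ⟨C, hC⟩ := hHd.decay N
        refine ⟨C, fun u => le_trans ?_ (hC (d * u))⟩
        refine mul_le_mul_of_nonneg_right (pow_le_pow_left₀ (by positivity) ?_ N) (abs_nonneg _)
        rw [abs_mul, abs_of_pos (one_pos.trans_le hd1), add_le_add_iff_left]
        exact le_mul_of_one_le_left (abs_nonneg u) hd1⟩
  have hJ : ∫ y, G (Q (a ^ α * y) / a) * H y = d * ∫ x, G (Q x / a) * H (d * x) := by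
    have := Measure.integral_comp_mul_left (fun x => G (Q x / a) * H (d * x)) (a ^ α)
    rw [abs_of_pos (by positivity), smul_eq_mul] at this
    rw [← this]
    refine integral_congr_ae (ae_of_all _ fun y => ?_)
    simp only [hd_def, inv_mul_cancel_left₀ haα.ne']
  have htail : |∫ x in (Set.Ioc (-δ) δ)ᶜ, G (Q x / a) * H (d * x)| ≤
      B * D * Real.pi * a ^ (M + 1) := by
    rw [← integral_indicator measurableSet_Ioc.compl]
    refine (norm_integral_le_of_norm_le (f := (Set.Ioc (-δ) δ)ᶜ.indicator
      fun x => G (Q x / a) * H (d * x))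
      (integrable_inv_one_add_sq.const_mul (B * D * a ^ (M + 1))) ?_).trans_eq ?_
    · have : ∀ᵐ x : ℝ, x ≠ -δ := by simp [ae_iff]
      filter_upwards [this] with x hxδ
      by_cases hx : x ∈ (Set.Ioc (-δ) δ)ᶜ
      · rw [Set.indicator_of_mem hx, norm_mul]
        have h1 : δ < |a ^ α * (d * x)| := by
          rw [had, lt_abs]
          simp only [Set.mem_compl_iff, Set.mem_Ioc, not_and_or, not_lt, not_le] at hx
          rcases hx with hx | hx
          · right
            have := lt_of_le_of_ne hx hxδ
            linarith
          · exact Or.inl hx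
        calc _ ≤ B * (D * a ^ (M + 1) * (1 + (d * x) ^ 2)⁻¹) := by
              gcongr
              exacts [hB _, hD a ha ha1 _ h1]
          _ ≤ B * (D * a ^ (M + 1) * (1 + x ^ 2)⁻¹) := by
              gcongr B * (D * a ^ (M + 1) * (1 + ?_)⁻¹)
              rw [mul_pow]
              exact le_mul_of_one_le_left (sq_nonneg x) (one_le_pow₀ hd1)
          _ = _ := by ring
      · rw [Set.indicator_of_notMem hx, norm_zero]
        positivity
    · rw [integral_const_mul, integral_univ_inv_one_add_sq]
      ring
  have hmain := hC b d hb hb1 hd1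
  rw [hbK, intervalIntegral.integral_of_le (by linarith)] at hmain
  have hall : |∫ x, G (Q x / a) * H (d * x)| ≤
      (C + B * D * Real.pi) * (d ^ M * b ^ (M + 1)) := by
    rw [← integral_add_compl measurableSet_Ioc hi, add_mul]
    refine (abs_add_le _ _).trans (add_le_add hmain (htail.trans ?_))
    gcongr
    calc a ^ (M + 1) ≤ 1 * b ^ (M + 1) := by rw [one_mul]; gcongr
      _ ≤ _ := by
        gcongr
        exact one_le_pow₀ hd1
  have hdb : d * b = a ^ ((K : ℝ)⁻¹ - α) := by
    rw [Real.rpow_sub ha, hd_def, inv_mul_eq_div]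
  have hdb1 : d * b ≤ 1 := by
    rw [hdb]
    refine Real.rpow_le_one ha.le ha1 ?_
    rw [sub_nonneg, inv_eq_one_div, le_div_iff₀ hK0]
    exact hαK.le
  rw [hJ, norm_mul, Real.norm_of_nonneg (by positivity : 0 ≤ d), Real.norm_eq_abs,
    Real.norm_of_nonneg (by positivity), Real.rpow_mul ha.le, Real.rpow_natCast, ← hdb]
  calc d * _ ≤ d * ((C + B * D * Real.pi) * (d ^ M * b ^ (M + 1))) := by gcongr
    _ = (C + B * D * Real.pi) * (d * b) ^ (M + 1) := by ring
    -- As αK < 1 gives db ≤ 1, the surplus factor db can be dropped.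
    _ ≤ (C + B * D * Real.pi) * (d * b) ^ M := by
      gcongr (C + B * D * Real.pi) * ?_
      exact pow_le_pow_of_le_one (by positivity) hdb1 (by omega)

end Taylorlet

end

/-! ### Assembly of the three cases -/

theorem theorem2 (n r j : ℕ) (hn : 1 ≤ n) (hj : j < r)
    (τ : 𝓢(ℝ × ℝ, ℝ)) (hτ : Taylorlet.IsAnalyzingTaylorlet n r τ)
    (σ : Taylorlet.Side) (q : ℝ → ℝ) (hq : ContDiff ℝ ∞ q)
    (α : ℝ) (hα : 0 < α) (s : Fin (n + 1) → ℝ) (t : ℝ) :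
    (∀ a : ℝ, 0 < a → Taylorlet.FeasibleConverges σ q j (Taylorlet.dilate α τ a s t)) ∧
    (s 0 ≠ q t → ∀ N : ℝ, 0 < N →
      (fun a : ℝ => Taylorlet.transform α τ (Taylorlet.feasible σ q j) a s t)
        =O[𝓝[>] 0] fun a : ℝ => a ^ N) ∧
    (α < 1 / (n : ℝ) → ∀ k : ℕ, k < n → Taylorlet.IsHighestApproxOrder q s t k →
      (fun a : ℝ => Taylorlet.transform α τ (Taylorlet.feasible σ q j) a s t)
        =O[𝓝[>] 0] fun a : ℝ =>
          a ^ ((j : ℝ) + (α - 1) / 2 + ((r : ℝ) - (j : ℝ)) * (1 - ((k : ℝ) + 1) * α))) ∧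
    (1 / ((n : ℝ) + 1) < α → Taylorlet.IsRestrictiveTaylorlet n r τ →
      Taylorlet.IsHighestApproxOrder q s t n →
      ∃ c : ℝ, c ≠ 0 ∧
        (fun a : ℝ => Taylorlet.transform α τ (Taylorlet.feasible σ q j) a s t)
          ~[𝓝[>] 0] fun a : ℝ => c * a ^ ((j : ℝ) + (α - 1) / 2)) := by
  open Taylorlet in
  obtain ⟨r', rfl⟩ := Nat.exists_eq_add_of_le' hj.le
  obtain ⟨g, h, hgh, hgm⟩ := hτ
  have key := fun a (ha : 0 < a) => feasibleConverges_and_transform_eq hn hj g.rapidDecay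
    h.rapidDecay hgh hgm σ hq α ha s t
  obtain ⟨hG, hGm⟩ := rapidDecay_iterInteg hn j g.rapidDecay hgm
  have hEq : (fun a : ℝ => transform α τ (feasible σ q j) a s t) =ᶠ[𝓝[>] 0]
      fun a => a ^ ((j : ℝ) + (α - 1) / 2) * (σ.sign ^ j *
        ∫ y, iterInteg .plus j g (defect q s t (a ^ α * y) / a) * h y) := by
    filter_upwards [self_mem_nhdsWithin] with a ha using (key a ha).2
  refine ⟨fun a ha => (key a ha).1, fun hs N _ => ?_, fun hαn k hk hap => ?_,
    fun hαn hres hap => ?_⟩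
  · obtain ⟨N', hN'⟩ := exists_nat_ge (N - ((j : ℝ) + (α - 1) / 2))
    have hO := isBigO_integral_of_ne_zero hG h.rapidDecay (contDiff_defect hq s t).continuous
      (by rw [defect_zero]; exact sub_ne_zero.2 hs.symm) hα N'
    refine hEq.trans_isBigO (((isBigO_refl _ _).mul (hO.const_mul_left _)).trans ?_)
    refine IsBigO.of_bound 1 ?_
    filter_upwards [Ioc_mem_nhdsGT one_pos] with a ⟨ha, ha1⟩
    rw [one_mul, Real.norm_of_nonneg (by positivity), Real.norm_of_nonneg (by positivity),
      ← Real.rpow_natCast, ← Real.rpow_add ha]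
    exact Real.rpow_le_rpow_of_exponent_ge ha ha1 (by linarith)
  · obtain ⟨-, hle, hne⟩ := hap
    obtain ⟨R, hR, hQR, hR0⟩ := exists_defect_eq_pow_mul hq s t hk.le hle
    have hR0' : R 0 ≠ 0 := by
      rw [hR0 ⟨k + 1, by omega⟩ rfl]
      exact div_ne_zero (sub_ne_zero.2 (hne ⟨k + 1, by omega⟩ rfl).symm)
        (by exact_mod_cast Nat.factorial_ne_zero _)
    have hαK : α * ((k + 1 : ℕ) : ℝ) < 1 := by
      rw [lt_div_iff₀ (by exact_mod_cast hn)] at hαn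
      refine lt_of_le_of_lt ?_ hαn
      gcongr
      omega
    have hO := isBigO_integral_of_moments hG (h.smooth _) h.rapidDecay hR hR0' (by omega) hQR
      (hGm (k + 1) (by omega) (by omega)) hα hαK
    refine hEq.trans_isBigO (((isBigO_refl _ _).mul (hO.const_mul_left _)).congr'
      EventuallyEq.rfl ?_)
    filter_upwards [self_mem_nhdsWithin] with a ha
    rw [← Real.rpow_add ha]
    -- The moments are used with M = (k+1)(r-j), and (1/(k+1) - α)M = (r-j)(1 - (k+1)α).
    congr 2
    have : (k : ℝ) + 1 ≠ 0 := by positivity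
    push_cast
    field_simp
    ring
  · obtain ⟨g', h', hgh', hgm', hg0, hh0⟩ := hres
    obtain ⟨-, hle, -⟩ := hap
    obtain ⟨R, hR, hQR, -⟩ := exists_defect_eq_pow_mul hq s t le_rfl hle
    have hG' := (rapidDecay_iterInteg hn j g'.rapidDecay hgm').1
    have hαn' : 1 < α * ((n + 1 : ℕ) : ℝ) := by
      rw [div_lt_iff₀ (by positivity)] at hαn
      exact_mod_cast hαn
    have hT := (tendsto_integral_of_eq_pow_mul hG' h'.rapidDecay hR.continuous hQR hα
      hαn').const_mul (σ.sign ^ j)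
    have hc : σ.sign ^ j * (iterInteg .plus j g' 0 * ∫ y, h' y) ≠ 0 :=
      mul_ne_zero (pow_ne_zero _ σ.sign_ne_zero) (mul_ne_zero (hg0 j (by omega)) hh0)
    refine ⟨_, hc, ?_⟩
    have hE := ((isEquivalent_const_iff_tendsto hc).2 hT).mul
      (IsEquivalent.refl (u := fun a : ℝ => a ^ ((j : ℝ) + (α - 1) / 2)) (l := 𝓝[>] 0))
    refine hE.congr_left ?_
    filter_upwards [self_mem_nhdsWithin] with a ha
    rw [(feasibleConverges_and_transform_eq hn hj g'.rapidDecay h'.rapidDecay hgh' hgm' σ hq α ha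
      s t).2]
    simp only [Pi.mul_apply]
    ring
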